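/- **Setting.** Let $d\ge 1$ and let $B=2^b\ge 4$. A data set $D$ is a finite set of $N$ distinct pairs $(key,rec)$, where $key$ is a vector of $d$ integers of $n_k$ bits each and $rec$ is a bit-string of $n_r$ bits. For $x,y$ in the key space, the $d$-dimensional quantum range query asks for the state $$QUERY(x,y)=\frac1{\sqrt k}\sum_{(key,rec)}|key\rangle|rec\rangle ,$$ the sum running over the $k$ pairs of $D$ with $x_j\le key_j\le y_j$ for all $j$. *Trees.* A weight-balanced B+ tree on one coordinate has all leaves on the same level; a leaf holds at most $B$ pairs sorted by that coordinate, an internal node has at most $B$ children. Every node has a unique identifier and a routing key $(L,U)$ such that all pairs below it have the coordinate in $[L,U]$; the ranges of the children lie in that of the parent and follow each other in order (common end points are allowed, since coordinates may repeat). Every non-root node of height $h$ has between $\frac14B^{h+1}$ and $B^{h+1}$ pairs below it, and a root that is not a leaf has at least two children. A $1$-dimensional range tree is such a tree; a $d$-dimensional one is such a tree on the $d$-th coordinate in which each internal node carries a $(d-1)$-dimensional range tree for the pairs below it. In the quantum range tree all nodes are written into QRAMs (loads $|a\rangle|v\rangle\mapsto|a\rangle|v\oplus Q[a]\rangle$):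 $Q_0$ holds at $(i,j)$ the $j$-th child of node $i$ (node $i$ itself if $i$ is a leaf), $Q_1$ the routing key of that child, or the $j$-th pair of the leaf $i$ (missing entries are a mark $dummy$); an inverse table holds at $(i,p)$ the place of the pair $p$ below the node $i$. *Query.* For $d\ge2$, in the B+ tree on the $d$-th coordinate, the search drops nodes whose range misses the query range, descends into nodes whose range is partly inside, turns to the attached $(d-1)$-dimensional tree at the topmost internal nodes whose range is inside, and scans leaves, which become candidates if they contain an answer. In a $1$-dimensional tree it goes down level by level, replacing the current list of nodes (at first the root) by their children that meet the query range, until some node of the list has a child inside the range, whereupon all nodes of the list become candidates, or the list consists of leaves, of which those containing an answer become candidates. If there is no candidate, nothing is returned. Otherwise, with $h(u)$ the height of a candidate $u$, the state $\sum_u\sqrt{B^{h(u)+1}/\sum_v B^{h(v)+1}}\,|u\rangle$ is prepared; edge indices are put into uniform superposition and children are loaded from $Q_0$ until all leaves below the candidates are reached (leaves being kept as they are); a uniform superposition of slots is formed and pairs are loaded from $Q_1$; a control qubit is flipped if the pair is in the query range, and measured. This is repeated from the preparation on until the outcome is $1$; then the address registers are reset to $0$ by inverse loads and the inverse table. *Time.*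 One step for each Hadamard gate, each load, each comparison, each word addition, each measurement, each routing key inspected, and each candidate in the preparation; order $d$ steps for testing a pair or for handling a node of a list. The expectation is over the measurement outcomes. **Theorem.** For all $d\ge1$ and $B=2^b\ge4$: every data set has a quantum range tree, and there is a constant $C$, depending only on $d$ and $B$, such that for every data set $D$, every quantum range tree of $D$, and all $x,y$: 1. if $k\ge1$, the query returns exactly the state $QUERY(x,y)$, all address registers being in the state $|0\rangle$; if $k=0$, it returns nothing; 2. if $N=|D|\ge2$, the expected time of the query is at most $C\log_B^d N$; 3. if $N\ge2$, at most $C\log_B^{d-1}N$ one-dimensional trees are searched. -/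

import Mathlib

open scoped ENNReal

namespace QuantumRange

/-! ## Data sets and quantum range queries -/

/-- A `d`-dimensional key: `d` integers of `nk` bits each (compared as unsigned integers). -/
abbrev Key (d nk : ℕ) : Type := Fin d → BitVec nk

/-- A key-record pair; a record is a bit-string of `nr` bits. -/
abbrev Pair (d nk nr : ℕ) : Type := Key d nk × BitVec nr

/-- The `i`-th coordinate of a key, counted from `0` (only used for `i < d`). -/
def coord {d nk : ℕ} (k : Key d nk) (i : ℕ) : BitVec nk :=
  if h : i < d then k ⟨i, h⟩ else 0

/-- The key `k` lies in the box with corners `x` and `y`. -/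
def InRange {d nk : ℕ} (x y k : Key d nk) : Prop := ∀ j, x j ≤ k j ∧ k j ≤ y j

instance {d nk : ℕ} (x y k : Key d nk) : Decidable (InRange x y k) :=
  inferInstanceAs (Decidable (∀ j, x j ≤ k j ∧ k j ≤ y j))

/-- The key-record pairs of the data set with key in the query range. -/
def answers {d nk nr : ℕ} (D : Finset (Pair d nk nr)) (x y : Key d nk) :
    Finset (Pair d nk nr) :=
  D.filter fun p => InRange x y p.1

/-- `QUERY(x, y) = (1/√k) ∑ |key⟩|rec⟩`, the sum over the `k` pairs with key in the range. -/
noncomputable def queryState {d nk nr : ℕ} (D : Finset (Pair d nk nr)) (x y : Key d nk) :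
    Pair d nk nr →₀ ℂ :=
  ((1 / √((answers D x y).card : ℝ) : ℝ) : ℂ) • ∑ p ∈ answers D x y, Finsupp.single p 1

/-! ## B+ trees and range trees

Node identifiers are non-zero words of `w` bits; the zero word is the mark `dummy`.
The branching factor is `B = 2 ^ b`. Dummy children and dummy pairs occupy the last positions
of a node, so a node is given by the list of its (at most `B`) non-dummy entries. -/

/-- A leaf with routing key `(lo, hi)`. -/
structure Leaf (d nk nr w : ℕ) : Type where
  id : BitVec w
  lo : BitVec nk
  hi : BitVec nk
  pairs : List (Pair d nk nr)

/-- An internal node with routing key `(lo, hi)`, carrying an attached structure `aux`. -/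
structure Inner (nk w : ℕ) (A C : Type) : Type where
  id : BitVec w
  lo : BitVec nk
  hi : BitVec nk
  aux : A
  children : List C

/-- A B+ tree node of a given height (the distance to the leaves, the same for all leaves below).
Its internal nodes carry attached structures of type `A`. -/
def Node (d nk nr w : ℕ) (A : Type) : ℕ → Type
  | 0 => Leaf d nk nr w
  | h + 1 => Inner nk w A (Node d nk nr w A h)

section Nodes

variable {d nk nr w : ℕ} {A : Type}

def Node.id : {h : ℕ} → Node d nk nr w A h → BitVec w
  | 0, v => Leaf.id v
  | _ + 1, v => Inner.id v

def Node.lo : {h : ℕ} → Node d nk nr w A h → BitVec nk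
  | 0, v => Leaf.lo v
  | _ + 1, v => Inner.lo v

def Node.hi : {h : ℕ} → Node d nk nr w A h → BitVec nk
  | 0, v => Leaf.hi v
  | _ + 1, v => Inner.hi v

def Node.children {h : ℕ} (v : Node d nk nr w A (h + 1)) : List (Node d nk nr w A h) :=
  Inner.children v

def Node.aux {h : ℕ} (v : Node d nk nr w A (h + 1)) : A := Inner.aux v

/-- The key-record pairs below a node, from left to right. -/
def Node.pairs : {h : ℕ} → Node d nk nr w A h → List (Pair d nk nr)
  | 0, v => Leaf.pairs v
  | _ + 1, v => v.children.flatMap Node.pairs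

/-- The weight of a node: the number of key-record pairs below it. -/
def Node.weight {h : ℕ} (v : Node d nk nr w A h) : ℕ := v.pairs.length

/-- A node of height `h` is balanced if its weight is between `B ^ (h + 1) / 4` and
`B ^ (h + 1)`. -/
def Node.Balanced (b : ℕ) {h : ℕ} (v : Node d nk nr w A h) : Prop :=
  (2 ^ b) ^ (h + 1) ≤ 4 * v.weight ∧ v.weight ≤ (2 ^ b) ^ (h + 1)

/-- All pairs below the node have their `i`-th coordinate in the range of the routing key. -/
def Node.Routed (i : ℕ) {h : ℕ} (v : Node d nk nr w A h) : Prop :=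
  ∀ p ∈ v.pairs, v.lo ≤ coord p.1 i ∧ coord p.1 i ≤ v.hi

/-- The subtree at a node is a B+ tree on the `i`-th coordinate in which all nodes below the top
one are balanced; `ok a l` says that the attached structure `a` is correct for the pairs `l`.
Different pairs may have the same `i`-th coordinate, so the ranges of consecutive children may
share an end point. -/
def Node.WellFormed (b i : ℕ) (ok : A → List (Pair d nk nr) → Prop) :
    {h : ℕ} → Node d nk nr w A h → Prop
  | 0, v =>
      (Node.pairs (A := A) (h := 0) v).length ≤ 2 ^ b ∧
      (Node.pairs (A := A) (h := 0) v).Pairwise (fun p q => coord p.1 i ≤ coord q.1 i) ∧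
      Node.Routed (A := A) i (h := 0) v
  | _ + 1, v =>
      v.children.length ≤ 2 ^ b ∧
      (∀ c ∈ v.children, c.WellFormed b i ok ∧ c.Balanced b ∧ v.lo ≤ c.lo ∧ c.hi ≤ v.hi) ∧
      v.children.Pairwise (fun c c' => c.hi ≤ c'.lo) ∧
      v.Routed i ∧
      ok v.aux v.pairs

/-- The root, if it is not a leaf, has at least two children. -/
def Node.RootDegree : {h : ℕ} → Node d nk nr w A h → Prop
  | 0, _ => True
  | _ + 1, v => 2 ≤ v.children.length

/-- The concatenation of the lists `f v` over all nodes `v` of the subtree and of the lists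
`g a` over all attached structures `a`. -/
def Node.collect {R : Type} (f : (h : ℕ) → Node d nk nr w A h → List R) (g : A → List R) :
    {h : ℕ} → Node d nk nr w A h → List R
  | 0, v => f 0 v
  | h + 1, v => f (h + 1) v ++ g v.aux ++ v.children.flatMap (Node.collect f g)

/-- All slots of leaves below a node that hold a pair: the pair, the indices of the edges that
lead from the node to the leaf, and the position in the leaf. -/
def Node.slots (b : ℕ) :
    {h : ℕ} → Node d nk nr w A h → List (Pair d nk nr × List (BitVec b) × BitVec b)
  | 0, v => (Leaf.pairs v).zipIdx.map fun s => (s.1, [], BitVec.ofNat b s.2)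
  | _ + 1, v => v.children.zipIdx.flatMap fun s =>
      (s.1.slots b).map fun r => (r.1, BitVec.ofNat b s.2 :: r.2.1, r.2.2)

end Nodes

/-- A B+ tree: a root node of some height. -/
structure BPlusTree (d nk nr w : ℕ) (A : Type) : Type where
  height : ℕ
  root : Node d nk nr w A height

/-- An `(n + 1)`-dimensional range tree is a B+ tree each of whose internal nodes carries an
`n`-dimensional range tree; a one-dimensional range tree is a B+ tree (with nothing attached). -/
def RangeTree (d nk nr w : ℕ) : ℕ → Type
  | 0 => Unit
  | n + 1 => BPlusTree d nk nr w (RangeTree d nk nr w n)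

section Trees

variable {d nk nr w : ℕ}

/-- `T` is an `n`-dimensional range tree for the given pairs and the first `n` coordinates: it is a
weight-balanced B+ tree on the `n`-th coordinate holding exactly these pairs, and the tree
attached to an internal node is an `(n - 1)`-dimensional range tree for the pairs below it. -/
def RangeTree.IsFor (b : ℕ) : (n : ℕ) → RangeTree d nk nr w n → List (Pair d nk nr) → Prop
  | 0, _, _ => True
  | n + 1, T, l =>
      (BPlusTree.root T).pairs.Perm l ∧
      (BPlusTree.root T).RootDegree ∧
      (BPlusTree.root T).WellFormed b n (RangeTree.IsFor b n)

/-- The concatenation of the lists `f v` over all nodes `v` of all B+ trees that make up the range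
tree. -/
def RangeTree.collect {R : Type} (f : (A : Type) → (h : ℕ) → Node d nk nr w A h → List R) :
    (n : ℕ) → RangeTree d nk nr w n → List R
  | 0, _ => []
  | n + 1, T => (BPlusTree.root T).collect (f _) (RangeTree.collect f n)

/-- The identifiers of all nodes. -/
def RangeTree.ids {n : ℕ} (T : RangeTree d nk nr w n) : List (BitVec w) :=
  T.collect (fun _ _ v => [v.id]) n

/-- `T` is a (`d`-dimensional, static) quantum range tree with branching factor `2 ^ b` for the
data set `D`. -/
structure IsQuantumRangeTree (b : ℕ) (D : Finset (Pair d nk nr)) (T : RangeTree d nk nr w d) :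
    Prop where
  isFor : T.IsFor b d D.toList
  ids_nodup : T.ids.Nodup
  dummy_notMem : (0 : BitVec w) ∉ T.ids

end Trees

/-! ## QRAM -/

/-- The content of a classical-write quantum-read memory. -/
def QRAM (α β : Type) : Type := α → β

/-- The store operation `Q[a] = v`. -/
noncomputable def QRAM.store {α β : Type} (Q : QRAM α β) (a : α) (v : β) : QRAM α β :=
  open Classical in Function.update Q a v

/-- The load operation on basis states: `|a⟩|v⟩ ↦ |a⟩|v ⊕ Q[a]⟩`. -/
def QRAM.load {α β : Type} [XorOp β] (Q : QRAM α β) (r : α × β) : α × β :=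
  (r.1, r.2 ^^^ Q r.1)

/-- The memory obtained from the all-zero one by a sequence of store operations. -/
noncomputable def QRAM.ofStores {α β : Type} (zero : β) (l : List (α × β)) : QRAM α β :=
  l.foldr (fun r Q => Q.store r.1 r.2) (fun _ => zero)

/-- A word of the data memory. The tag tells what it holds: `0` for `dummy`, `1` for a routing
key `(lo, hi)`, `2` for a key-record pair. -/
@[ext]
structure DataWord (d nk nr : ℕ) : Type where
  tag : BitVec 2
  lo : BitVec nk
  hi : BitVec nk
  key : Key d nk
  record : BitVec nr

instance {d nk nr : ℕ} : XorOp (DataWord d nk nr) where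
  xor u v := ⟨u.tag ^^^ v.tag, u.lo ^^^ v.lo, u.hi ^^^ v.hi, fun j => u.key j ^^^ v.key j,
    u.record ^^^ v.record⟩

def DataWord.dummy (d nk nr : ℕ) : DataWord d nk nr := ⟨0, 0, 0, fun _ => 0, 0⟩

def DataWord.routing (d : ℕ) {nk : ℕ} (nr : ℕ) (lo hi : BitVec nk) : DataWord d nk nr :=
  ⟨1, lo, hi, fun _ => 0, 0⟩

def DataWord.ofPair {d nk nr : ℕ} (p : Pair d nk nr) : DataWord d nk nr := ⟨2, 0, 0, p.1, p.2⟩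

section Memory

variable {d nk nr w : ℕ}

/-- The numbers `0, …, B - 1`. -/
def indices (b : ℕ) : List (BitVec b) := (List.finRange (2 ^ b)).map BitVec.ofFin

/-- For the node `i` and each `j < B`, the store operation `Q₀[i * B + j] = C_{i,j}`, where
`C_{i,j}` is the `j`-th child of `i` (or `dummy`), and `C_{i,j} = i` if `i` is a leaf. The address
`i * B + j` is the concatenation of the words `i` and `j`. -/
def childStores (b : ℕ) (A : Type) :
    (h : ℕ) → Node d nk nr w A h → List ((BitVec w × BitVec b) × BitVec w)
  | 0, v => (indices b).map fun j => ((Leaf.id v, j), Leaf.id v)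
  | _ + 1, v => (indices b).map fun j =>
      ((v.id, j), (v.children[j.toNat]?.map Node.id).getD 0)

/-- For the node `i` and each `j < B`, the store operation `Q₁[i * B + j] = P_{i,j}`, where
`P_{i,j}` is the `j`-th pair of the leaf `i`, or the routing key of the `j`-th child of the
internal node `i` (or `dummy`). -/
def dataStores (b : ℕ) (A : Type) :
    (h : ℕ) → Node d nk nr w A h → List ((BitVec w × BitVec b) × DataWord d nk nr)
  | 0, v => (indices b).map fun j =>
      ((Leaf.id v, j), ((Leaf.pairs v)[j.toNat]?.map DataWord.ofPair).getD (.dummy d nk nr))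
  | _ + 1, v => (indices b).map fun j =>
      ((v.id, j), (v.children[j.toNat]?.map fun c => DataWord.routing d nr c.lo c.hi).getD
        (.dummy d nk nr))

/-- For the node `i` and each pair `p` below it, the store operation that records at the address
`(i, p)` where `p` is to be found below `i`. -/
def slotStores (b : ℕ) (A : Type) (h : ℕ) (v : Node d nk nr w A h) :
    List ((BitVec w × Pair d nk nr) × Option (List (BitVec b) × BitVec b)) :=
  (v.slots b).map fun s => ((v.id, s.1), some s.2)

/-- The quantum memory: the hierarchy memory `Q₀`, the data memory `Q₁`, and the inverse address
table, which is used only to reset address registers to zero. -/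
structure Memory (d nk nr w b : ℕ) : Type where
  hierarchy : QRAM (BitVec w × BitVec b) (BitVec w)
  data : QRAM (BitVec w × BitVec b) (DataWord d nk nr)
  slots : QRAM (BitVec w × Pair d nk nr) (Option (List (BitVec b) × BitVec b))

/-- The memory that represents a range tree. -/
noncomputable def RangeTree.memory (b : ℕ) {n : ℕ} (T : RangeTree d nk nr w n) :
    Memory d nk nr w b where
  hierarchy := QRAM.ofStores 0 (T.collect (childStores b) n)
  data := QRAM.ofStores (.dummy d nk nr) (T.collect (dataStores b) n)
  slots := QRAM.ofStores none (T.collect (slotStores b) n)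

end Memory

/-! ## The classical part of the query

The search returns a list of candidate nodes. Comparing a query range with a routing key costs
one step; testing a key against the query range costs `d` steps, one for each coordinate, and
handling a node of a list is charged `d` steps as well. -/

/-- The outcome of a classical search: the candidate nodes (identifier and height), the number
of steps, and the number of one-dimensional trees that were searched. -/
structure Found (w : ℕ) : Type where
  cands : List (BitVec w × ℕ)
  steps : ℕ
  oneDim : ℕ

/-- The outcome of several searches made one after the other. -/
def Found.concat {w : ℕ} (l : List (Found w)) : Found w where
  cands := l.flatMap Found.cands
  steps := (l.map Found.steps).sum
  oneDim := (l.map Found.oneDim).sum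

def Found.addSteps {w : ℕ} (s : ℕ) (F : Found w) : Found w := { F with steps := F.steps + s }

section Search

variable {d nk nr w : ℕ} {A : Type}

/-- With respect to the `i`-th coordinate, the range of the node lies inside the query range. -/
def Node.Inside (x y : Key d nk) (i : ℕ) {h : ℕ} (v : Node d nk nr w A h) : Prop :=
  coord x i ≤ v.lo ∧ v.hi ≤ coord y i

/-- With respect to the `i`-th coordinate, the range of the node and the query range do not
overlap. A node that is neither inside nor outside is partial. -/
def Node.Outside (x y : Key d nk) (i : ℕ) {h : ℕ} (v : Node d nk nr w A h) : Prop :=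
  v.hi < coord x i ∨ coord y i < v.lo

instance (x y : Key d nk) (i : ℕ) {h : ℕ} (v : Node d nk nr w A h) :
    Decidable (v.Inside x y i) :=
  inferInstanceAs (Decidable (_ ∧ _))

instance (x y : Key d nk) (i : ℕ) {h : ℕ} (v : Node d nk nr w A h) :
    Decidable (v.Outside x y i) :=
  inferInstanceAs (Decidable (_ ∨ _))

/-- Scanning a leaf: it is a candidate if it contains an answer. -/
def scanLeaf (x y : Key d nk) (v : Leaf d nk nr w) : Found w where
  cands := if ∃ p ∈ v.pairs, InRange x y p.1 then [(v.id, 0)] else []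
  steps := d + d * v.pairs.length
  oneDim := 0

/-- The global classical search in a B+ tree on the `i`-th coordinate, at the level of the nodes
in `L`. If one of them is precise, that is, a leaf or a node with an inside child, then `L` is
returned (without the leaves that contain no answer); otherwise the nodes of `L` are replaced by
their children that are not outside. -/
def globalSearch (x y : Key d nk) (i : ℕ) : (h : ℕ) → List (Node d nk nr w A h) → Found w
  | 0, L => Found.concat (L.map (scanLeaf x y))
  | h + 1, L =>
      let kids : List (Node d nk nr w A h) := L.flatMap Node.children
      let s : ℕ := d * L.length + kids.length
      if ∃ c ∈ kids, c.Inside x y i then ⟨L.map fun v => (v.id, h + 1), s, 0⟩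
      else (globalSearch x y i h (kids.filter fun c => ¬ c.Outside x y i)).addSteps s

/-- The search in a B+ tree on the `i`-th coordinate whose internal nodes carry trees for the
remaining coordinates: outside nodes are dropped, `inner` is called on the trees attached to the
topmost inside internal nodes, the search descends into partial nodes, and leaves are scanned. -/
def coverSearch (x y : Key d nk) (i : ℕ) (inner : A → Found w) :
    {h : ℕ} → Node d nk nr w A h → Found w
  | 0, v =>
      if Node.Outside (A := A) x y i (h := 0) v then ⟨[], 1, 0⟩
      else (scanLeaf x y v).addSteps 1
  | _ + 1, v =>
      if v.Outside x y i then ⟨[], 1, 0⟩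
      else if v.Inside x y i then (inner v.aux).addSteps 1
      else (Found.concat (v.children.map (coverSearch x y i inner))).addSteps 1

/-- The classical search in a range tree: down to the one-dimensional trees, and in each of these
the global classical search from its root. -/
def RangeTree.search (x y : Key d nk) : (n : ℕ) → RangeTree d nk nr w n → Found w
  | 0, _ => ⟨[], 0, 0⟩
  | 1, T => { globalSearch x y 0 (BPlusTree.height T) [BPlusTree.root T] with oneDim := 1 }
  | n + 2, T => coverSearch x y (n + 1) (RangeTree.search x y (n + 1)) (BPlusTree.root T)

end Search

/-! ## The quantum part of the query -/

/-- A basis state of the quantum registers: node registers, edge-index registers (a supply of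
registers which are zero unless used), the data register, and the control qubit. -/
@[ext]
structure Config (d nk nr w b : ℕ) : Type where
  node : ℕ → BitVec w
  idx : ℕ → BitVec b
  data : DataWord d nk nr
  flag : Bool

/-- A superposition of basis states. -/
abbrev State (d nk nr w b : ℕ) : Type := Config d nk nr w b →₀ ℂ

/-- The gates. -/
inductive Gate (w : ℕ) : Type where
  /-- Hadamard gates on all qubits of the edge-index register `t`, controlled by the node
  register `t` not holding a leaf. -/
  | branch (t : ℕ) : Gate w
  /-- Hadamard gates on all qubits of the edge-index register `t`. -/
  | spread (t : ℕ) : Gate w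
  /-- Load from `Q₀`, with the node and edge-index registers `t` as the address, into the node
  register `t + 1`. -/
  | loadChild (t : ℕ) : Gate w
  /-- Load from `Q₁`, with the node and edge-index registers `t` as the address, into the data
  register. -/
  | loadData (t : ℕ) : Gate w
  /-- Flip the control qubit if the data register holds a pair with key in the query range. -/
  | mark : Gate w
  /-- Look up the pair in the data register below the node `u`; if it is there, add (bitwise) `u`
  to the node register `0`, the edges leading to it to the edge-index registers `0, 1, …`, and
  its position to the edge-index register `t`. -/
  | erase (t : ℕ) (u : BitVec w) : Gate w

section Quantum

variable {d nk nr w b : ℕ}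

/-- `(-1) ^ (a · j)` for the dot product of bit-strings. -/
def dotSign (a j : BitVec b) : ℂ := ∏ i : Fin b, if a[i] && j[i] then -1 else 1

/-- The Hadamard gate on each qubit of the edge-index register `t`:
`|a⟩ ↦ 2 ^ (-b / 2) ∑ j, (-1) ^ (a · j) |j⟩`. -/
noncomputable def hadamard (t : ℕ) (c : Config d nk nr w b) : State d nk nr w b :=
  ∑ j : BitVec b, Finsupp.single { c with idx := Function.update c.idx t j }
    (((1 / √((2 : ℝ) ^ b) : ℝ) : ℂ) * dotSign (c.idx t) j)

/-- The node register `t` holds a leaf: `Q₀` leads from it to itself. -/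
def AtLeaf (M : Memory d nk nr w b) (t : ℕ) (c : Config d nk nr w b) : Prop :=
  c.node t ≠ 0 ∧ M.hierarchy (c.node t, 0) = c.node t

/-- The action of a gate on a basis state. -/
noncomputable def Gate.onBasis (M : Memory d nk nr w b) (x y : Key d nk)
    (c : Config d nk nr w b) : Gate w → State d nk nr w b
  | .branch t => open Classical in if AtLeaf M t c then Finsupp.single c 1 else hadamard t c
  | .spread t => hadamard t c
  | .loadChild t => Finsupp.single { c with
      node := Function.update c.node (t + 1)
        (M.hierarchy.load ((c.node t, c.idx t), c.node (t + 1))).2 } 1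
  | .loadData t => Finsupp.single { c with
      data := (M.data.load ((c.node t, c.idx t), c.data)).2 } 1
  | .mark => Finsupp.single { c with
      flag := xor c.flag (decide (c.data.tag = 2 ∧ InRange x y c.data.key)) } 1
  | .erase t u => Finsupp.single
      (match M.slots (u, (c.data.key, c.data.record)) with
        | none => c
        | some s => { c with
            node := Function.update c.node 0 (c.node 0 ^^^ u)
            idx := fun r => c.idx r ^^^ (if r = t then s.2 else s.1.getD r 0) }) 1

/-- The action of a gate on superpositions. -/
noncomputable def Gate.apply (M : Memory d nk nr w b) (x y : Key d nk) (g : Gate w)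
    (ψ : State d nk nr w b) : State d nk nr w b :=
  ψ.sum fun c a => a • g.onBasis M x y c

/-- The time of a gate: one step for each Hadamard gate, each load and each comparison. The leaf
test of `branch` takes a load and its inverse; `erase` takes two loads and
the bitwise addition of the `t + 2` words found. -/
def Gate.time (d b : ℕ) : Gate w → ℕ
  | .branch _ => b + 2
  | .spread _ => b
  | .loadChild _ => 1
  | .loadData _ => 1
  | .mark => 2 * d + 1
  | .erase t _ => t + 4

/-- The effect of a circuit, its gates being applied from left to right. -/
noncomputable def runCircuit (M : Memory d nk nr w b) (x y : Key d nk) (l : List (Gate w))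
    (ψ : State d nk nr w b) : State d nk nr w b :=
  l.foldl (fun φ g => g.apply M x y φ) ψ

def circuitTime (d b : ℕ) (l : List (Gate w)) : ℕ := (l.map (Gate.time d b)).sum

/-- The initial state `∑ √(B ^ (h(u) + 1) / S) |u⟩` on the candidates `u`, where
`S = ∑ B ^ (h(u) + 1)`. Its preparation costs one step for each candidate. -/
noncomputable def prepare (d nk nr b : ℕ) (L : List (BitVec w × ℕ)) : State d nk nr w b :=
  (L.map fun u => Finsupp.single
    (⟨Function.update (fun _ => 0) 0 u.1, fun _ => 0, .dummy d nk nr, false⟩ :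
      Config d nk nr w b)
    ((√(((2 : ℝ) ^ b) ^ (u.2 + 1) /
      (L.map fun v => ((2 : ℝ) ^ b) ^ (v.2 + 1)).sum) : ℝ) : ℂ)).sum

/-- The largest height of a candidate. -/
def topHeight (L : List (BitVec w × ℕ)) : ℕ := (L.map Prod.snd).foldr max 0

/-- The circuit that leads from candidates of height at most `H` to all pairs below them and
marks the answers. -/
def walkCircuit (w H : ℕ) : List (Gate w) :=
  (List.range H).flatMap (fun t => [.branch t, .loadChild t]) ++
    [.spread H, .loadData H, .mark]

/-- The circuit that resets all address registers. -/
def resetCircuit (H : ℕ) (L : List (BitVec w × ℕ)) : List (Gate w) :=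
  (List.range H).reverse.map .loadChild ++ L.map fun u => .erase H u.1

/-- The state before the control qubit is measured. -/
noncomputable def walkState (M : Memory d nk nr w b) (x y : Key d nk) (L : List (BitVec w × ℕ)) :
    State d nk nr w b :=
  runCircuit M x y (walkCircuit w (topHeight L)) (prepare d nk nr b L)

/-- The part of a state in which the control qubit is `1`. -/
noncomputable def flagged (ψ : State d nk nr w b) : State d nk nr w b :=
  ψ.filter fun c => c.flag = true

/-- The probability that the measurement of the control qubit of the unit vector `ψ` yields
`1`. -/
noncomputable def successProb (ψ : State d nk nr w b) : ℝ :=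
  (flagged ψ).sum fun _ a => ‖a‖ ^ 2

/-- The state after the control qubit of the unit vector `ψ` has been measured to be `1`. -/
noncomputable def postSelect (ψ : State d nk nr w b) : State d nk nr w b :=
  ((1 / √(successProb ψ) : ℝ) : ℂ) • flagged ψ

/-- The time of one attempt of the local quantum search, with the final measurement. -/
def attemptTime (d b : ℕ) (L : List (BitVec w × ℕ)) : ℕ :=
  L.length + circuitTime d b (walkCircuit w (topHeight L)) + 1

/-- The basis state in which the data register holds the pair `p`, the control qubit is `1`, and
all address registers are zero. -/
def output (w b : ℕ) (p : Pair d nk nr) : Config d nk nr w b :=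
  ⟨fun _ => 0, fun _ => 0, .ofPair p, true⟩

/-- The state returned by the query: nothing if the classical search finds no candidate;
otherwise the local quantum search is repeated until the control qubit is measured to be `1`, and
then the address registers are reset. -/
noncomputable def RangeTree.answer (b : ℕ) {n : ℕ} (T : RangeTree d nk nr w n) (x y : Key d nk) :
    Option (State d nk nr w b) :=
  let L := (T.search x y n).cands
  if L = [] then none
  else some (runCircuit (T.memory b) x y (resetCircuit (topHeight L) L)
    (postSelect (walkState (T.memory b) x y L)))

/-- The expected time of the query. The attempt number `m + 1` of the local quantum search takes
place if the first `m` attempts, which are independent, have failed. -/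
noncomputable def RangeTree.expectedTime (b : ℕ) {n : ℕ} (T : RangeTree d nk nr w n)
    (x y : Key d nk) : ℝ≥0∞ :=
  let L := (T.search x y n).cands
  if L = [] then ((T.search x y n).steps : ℝ≥0∞)
  else ((T.search x y n).steps : ℝ≥0∞) +
    (∑' m : ℕ, ENNReal.ofReal (1 - successProb (walkState (T.memory b) x y L)) ^ m *
      (attemptTime d b L : ℝ≥0∞)) +
    (circuitTime d b (resetCircuit (topHeight L) L) : ℝ≥0∞)

end Quantum

end QuantumRange

/-!
Why the theorem holds.

*Existence.* Sort the pairs by the last coordinate and cut the list into consecutive pieces, level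
by level. Since `4` divides `B`, a list of a length allowed for a node of height `h + 1` can be cut
into `B` pieces of lengths allowed for height `h` (`exists_pieces`, `nodeExists_of_balanced`); the
root takes as few children as possible, and these are at least two (`treeExists`). The trees
attached to internal nodes come from the induction on the dimension, and identifiers are drawn
from disjoint intervals of numbers.

*Correctness of the search.* The candidates have all answers below them, each one below exactly
one candidate (`Found.Correct`, proved in `RangeTree.correct_search`). Moreover the answers make up
at least the fraction `1 / (8 * B)` of the `S = ∑ B ^ (h(u) + 1)` places below the candidates `u`:
in a one-dimensional tree the list of nodes has at most two members, because only nodes whose range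
contains an end point of the query range survive (`Node.length_le_two_of_partial`), and when a child
is inside the range, all of the at least `B ^ (h + 1) / 4` pairs below it are answers.

*The quantum walk.* From a candidate of height `h` the walk reaches every slot below it with the
amplitude `B ^ (-(h + 1) / 2)`, leaves being kept and walks into `dummy` never raising the control
qubit (`flagged_walkFrom`). With the initial amplitude `√(B ^ (h + 1) / S)` every answer ends up
with the amplitude `1 / √S` (`flagged_walkState`). So an attempt succeeds with probability `k / S`,
which is at least `1 / (8 * B)`, and leaves the uniform superposition of the answers; the reset
clears the registers because the path to an answer is determined by the one candidate above it
(`circuitMap_reset`).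

*Time.* With `m` of the order of `log N`, the steps of the search, and `m` times the number of
candidates and of one-dimensional trees, are together bounded by a constant times `m ^ d`
(`RangeTree.cost_search_le`): a level of a B+ tree has at most two partial nodes, hence at most
`2 * B` nodes of each level are visited (`cost_coverSearch_le`). An attempt and the reset
take time `O(m)` for the walk and at most `O(m)` for each of the `O(m ^ (d - 1))` candidates, and the
expected number of attempts is at most `8 * B` (`tsum_attempts_le`).
-/

namespace QuantumRange

/-! ### The nodes of a range tree -/

/-- A node of one of the B+ trees that make up a range tree: the dimension of the trees attached
to it (hence the coordinate that its B+ tree is sorted by), its height, and the node itself. -/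
abbrev SNode (d nk nr w : ℕ) : Type :=
  Σ (n : ℕ) (h : ℕ), Node d nk nr w (RangeTree d nk nr w n) h

section Nodes

variable {d nk nr w b : ℕ}

def SNode.id (s : SNode d nk nr w) : BitVec w := Node.id s.2.2

def SNode.height (s : SNode d nk nr w) : ℕ := s.2.1

def SNode.pairs (s : SNode d nk nr w) : List (Pair d nk nr) := Node.pairs s.2.2

/-- All nodes of all B+ trees that make up a range tree, in the order of
`RangeTree.collect`. -/
def RangeTree.nodes : (n : ℕ) → RangeTree d nk nr w n → List (SNode d nk nr w)
  | 0, _ => []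
  | n + 1, T => (BPlusTree.root T).collect (fun h v => [⟨n, h, v⟩]) (RangeTree.nodes n)

theorem Node.collect_flatMap {A R S : Type} (f : (h : ℕ) → Node d nk nr w A h → List R)
    (g : A → List R) (k : R → List S) {h : ℕ} (v : Node d nk nr w A h) :
    (v.collect f g).flatMap k =
      v.collect (fun h v => (f h v).flatMap k) (fun a => (g a).flatMap k) := by
  induction h with
  | zero => rfl
  | succ h ih =>
    simp only [Node.collect, List.flatMap_append, List.flatMap_assoc, ih]

/-- Every collection over a range tree runs over its list of nodes. -/
theorem RangeTree.collect_eq {R : Type} (f : (A : Type) → (h : ℕ) → Node d nk nr w A h → List R)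
    (n : ℕ) (T : RangeTree d nk nr w n) :
    T.collect f n = (T.nodes n).flatMap fun s => f _ _ s.2.2 := by
  induction n with
  | zero => rfl
  | succ n ih =>
    simp only [RangeTree.collect, RangeTree.nodes, Node.collect_flatMap, List.flatMap_singleton]
    congr 1
    funext a
    exact ih a

theorem RangeTree.ids_eq {n : ℕ} (T : RangeTree d nk nr w n) :
    T.ids = (T.nodes n).map SNode.id := by
  rw [RangeTree.ids, RangeTree.collect_eq, List.map_eq_flatMap]
  rfl

theorem Node.self_mem_collect {n h : ℕ} (v : Node d nk nr w (RangeTree d nk nr w n) h)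
    (g : RangeTree d nk nr w n → List (SNode d nk nr w)) :
    (⟨n, h, v⟩ : SNode d nk nr w) ∈ v.collect (fun h v => [⟨n, h, v⟩]) g := by
  cases h <;> simp [Node.collect]

/-- The nodes of a range tree are closed under passing to children. -/
theorem RangeTree.child_mem_nodes {n : ℕ} {T : RangeTree d nk nr w n} {m h : ℕ}
    {v : Node d nk nr w (RangeTree d nk nr w m) (h + 1)} (hv : ⟨m, h + 1, v⟩ ∈ T.nodes n)
    {c : Node d nk nr w (RangeTree d nk nr w m) h} (hc : c ∈ v.children) :
    ⟨m, h, c⟩ ∈ T.nodes n := by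
  induction n with
  | zero => simp [RangeTree.nodes] at hv
  | succ n ih =>
    simp only [RangeTree.nodes] at hv ⊢
    generalize BPlusTree.root T = r at hv ⊢
    generalize BPlusTree.height T = k at r hv ⊢
    induction k with
    | zero =>
      simp only [Node.collect, List.mem_singleton] at hv
      have := congrArg (fun s : SNode d nk nr w => s.2.1) hv
      simp at this
    | succ k ihk =>
      simp only [Node.collect, List.mem_append, List.mem_flatMap, List.mem_singleton] at hv ⊢
      rcases hv with (hv | hv) | ⟨c', hc', hv⟩
      · cases hv
        exact Or.inr ⟨c, hc, Node.self_mem_collect c _⟩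
      · exact Or.inl (Or.inr (ih hv))
      · exact Or.inr ⟨c', hc', ihk c' hv⟩

/-- Every node of a range tree is well-formed for the coordinate of its B+ tree. -/
theorem RangeTree.IsFor.wellFormed {n : ℕ} {T : RangeTree d nk nr w n}
    {l : List (Pair d nk nr)} (hT : T.IsFor b n l) {s : SNode d nk nr w} (hs : s ∈ T.nodes n) :
    s.2.2.WellFormed b s.1 (RangeTree.IsFor b s.1) := by
  induction n generalizing l with
  | zero => simp [RangeTree.nodes] at hs
  | succ n ih =>
    obtain ⟨-, -, hT⟩ := hT
    simp only [RangeTree.nodes] at hs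
    generalize BPlusTree.root T = r at hs hT
    generalize BPlusTree.height T = k at r hs hT
    induction k with
    | zero =>
      simp only [Node.collect, List.mem_singleton] at hs
      subst hs
      exact hT
    | succ k ihk =>
      simp only [Node.collect, List.mem_append, List.mem_flatMap, List.mem_singleton] at hs
      rcases hs with (hs | hs) | ⟨c, hc, hs⟩
      · subst hs
        exact hT
      · exact ih hT.2.2.2.2 hs
      · exact ihk c hs (hT.2.1 c hc).1

/-- The entries of the inverse table for a node are, in order, the pairs below it. -/
theorem Node.map_fst_slots {A : Type} {h : ℕ} (v : Node d nk nr w A h) :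
    (v.slots b).map Prod.fst = v.pairs := by
  induction h with
  | zero =>
    simp only [Node.slots, Node.pairs, List.map_map]
    exact List.zipIdx_map_fst 0 _
  | succ h ih =>
    simp only [Node.slots, Node.pairs, List.map_flatMap, List.map_map]
    conv_rhs => rw [← List.zipIdx_map_fst 0 v.children, List.flatMap_map]
    congr 1
    funext s
    rw [← ih s.1]
    rfl

theorem Node.mem_pairs_of_mem_slots {A : Type} {h : ℕ} {v : Node d nk nr w A h}
    {s : Pair d nk nr × List (BitVec b) × BitVec b} (hs : s ∈ v.slots b) : s.1 ∈ v.pairs := by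
  rw [← Node.map_fst_slots (b := b)]
  exact List.mem_map_of_mem hs

theorem Node.length_of_mem_slots {A : Type} {h : ℕ} {v : Node d nk nr w A h}
    {s : Pair d nk nr × List (BitVec b) × BitVec b} (hs : s ∈ v.slots b) :
    s.2.1.length = h := by
  induction h generalizing s with
  | zero =>
    simp only [Node.slots, List.mem_map] at hs
    obtain ⟨a, -, rfl⟩ := hs
    rfl
  | succ h ih =>
    simp only [Node.slots, List.mem_map, List.mem_flatMap] at hs
    obtain ⟨a, -, r, hr, rfl⟩ := hs
    simp [ih hr]

end Nodes

/-! ### The content of the memory -/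

theorem QRAM.ofStores_cons_of_eq {α β : Type} {z : β} {r : α × β} {l : List (α × β)} :
    QRAM.ofStores z (r :: l) r.1 = r.2 := by
  classical exact Function.update_self (β := fun _ => β) r.1 r.2 _

theorem QRAM.ofStores_cons_of_ne {α β : Type} {z : β} {r : α × β} {l : List (α × β)} {a : α}
    (h : r.1 ≠ a) : QRAM.ofStores z (r :: l) a = QRAM.ofStores z l a := by
  classical exact Function.update_of_ne (β := fun _ => β) h.symm r.2 _

theorem QRAM.ofStores_eq_zero {α β : Type} {z : β} {l : List (α × β)} {a : α}
    (h : ∀ r ∈ l, r.1 ≠ a) : QRAM.ofStores z l a = z := by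
  induction l with
  | nil => rfl
  | cons r l ih =>
    rw [QRAM.ofStores_cons_of_ne (h r List.mem_cons_self)]
    exact ih fun r hr => h r (List.mem_cons_of_mem _ hr)

theorem QRAM.ofStores_eq {α β : Type} {z : β} {l : List (α × β)} {a : α} {v : β}
    (hmem : (a, v) ∈ l) (h : ∀ v', (a, v') ∈ l → v' = v) : QRAM.ofStores z l a = v := by
  induction l with
  | nil => simp at hmem
  | cons r l ih =>
    by_cases h1 : r.1 = a
    · subst h1
      rw [QRAM.ofStores_cons_of_eq]
      exact h _ List.mem_cons_self
    · rw [QRAM.ofStores_cons_of_ne h1]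
      refine ih ?_ fun v' hv' => h v' (List.mem_cons_of_mem _ hv')
      rcases List.mem_cons.1 hmem with rfl | h2
      · exact absurd rfl h1
      · exact h2

section Memory

variable {d nk nr w b : ℕ}

theorem mem_indices (j : BitVec b) : j ∈ indices b :=
  List.mem_map.2 ⟨j.toFin, List.mem_finRange _, rfl⟩

/-- The hierarchy and data memories hold the subtree at a node `v`, all identifiers in it being
nonzero; that no internal node is its own child at place `0` is what makes the test for
leaves work. -/
def Represents {A : Type} (M : Memory d nk nr w b) : {h : ℕ} → Node d nk nr w A h → Prop
  | 0, v => Leaf.id v ≠ 0 ∧ (Leaf.pairs v).length ≤ 2 ^ b ∧ ∀ j : BitVec b,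
      M.hierarchy (Leaf.id v, j) = Leaf.id v ∧
      M.data (Leaf.id v, j) =
        ((Leaf.pairs v)[j.toNat]?.map DataWord.ofPair).getD (.dummy d nk nr)
  | _ + 1, v => v.id ≠ 0 ∧ v.children.length ≤ 2 ^ b ∧ M.hierarchy (v.id, 0) ≠ v.id ∧
      (∀ j : BitVec b, M.hierarchy (v.id, j) = (v.children[j.toNat]?.map Node.id).getD 0) ∧
      ∀ c ∈ v.children, Represents M c

/-- The node address `0` leads to `dummy` entries only. -/
structure Memory.ZeroDummy (M : Memory d nk nr w b) : Prop where
  hierarchy : ∀ j, M.hierarchy (0, j) = 0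
  data : ∀ j, M.data (0, j) = .dummy d nk nr

theorem fst_of_mem_childStores {A : Type} {h : ℕ} {v : Node d nk nr w A h}
    {r : (BitVec w × BitVec b) × BitVec w} (hr : r ∈ childStores b A h v) :
    r.1.1 = v.id := by
  cases h <;> simp only [childStores, List.mem_map] at hr <;> obtain ⟨j, -, rfl⟩ := hr <;> rfl

theorem fst_of_mem_dataStores {A : Type} {h : ℕ} {v : Node d nk nr w A h}
    {r : (BitVec w × BitVec b) × DataWord d nk nr} (hr : r ∈ dataStores b A h v) :
    r.1.1 = v.id := by
  cases h <;> simp only [dataStores, List.mem_map] at hr <;> obtain ⟨j, -, rfl⟩ := hr <;> rfl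

theorem fst_of_mem_slotStores {A : Type} {h : ℕ} {v : Node d nk nr w A h}
    {r : (BitVec w × Pair d nk nr) × Option (List (BitVec b) × BitVec b)}
    (hr : r ∈ slotStores b A h v) : r.1.1 = v.id := by
  simp only [slotStores, List.mem_map] at hr
  obtain ⟨j, -, rfl⟩ := hr
  rfl

namespace IsQuantumRangeTree

variable {D : Finset (Pair d nk nr)} {T : RangeTree d nk nr w d}

theorem id_ne_zero (hT : IsQuantumRangeTree b D T) {s : SNode d nk nr w}
    (hs : s ∈ T.nodes d) : s.id ≠ 0 := fun h =>
  hT.dummy_notMem (by rw [RangeTree.ids_eq, ← h]; exact List.mem_map_of_mem hs)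

theorem eq_of_id_eq (hT : IsQuantumRangeTree b D T) {s s' : SNode d nk nr w}
    (hs : s ∈ T.nodes d) (hs' : s' ∈ T.nodes d) (h : s.id = s'.id) : s = s' := by
  have := hT.ids_nodup
  rw [RangeTree.ids_eq] at this
  exact List.inj_on_of_nodup_map this hs hs' h

/-- Looking up an address of a node in a memory filled from all nodes gives what that node has
stored there, because identifiers are unique. -/
theorem ofStores_collect (hT : IsQuantumRangeTree b D T) {α β : Type} {z : β}
    {f : (A : Type) → (h : ℕ) → Node d nk nr w A h → List ((BitVec w × α) × β)}
    (hf : ∀ (A : Type) (h : ℕ) (v : Node d nk nr w A h), ∀ r ∈ f A h v, r.1.1 = v.id)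
    {s : SNode d nk nr w} (hs : s ∈ T.nodes d) {j : α} {v : β}
    (hmem : ((s.id, j), v) ∈ f _ _ s.2.2)
    (huniq : ∀ v', ((s.id, j), v') ∈ f _ _ s.2.2 → v' = v) :
    QRAM.ofStores z (T.collect f d) (s.id, j) = v := by
  rw [RangeTree.collect_eq]
  refine QRAM.ofStores_eq (List.mem_flatMap.2 ⟨s, hs, hmem⟩) fun v' hv' => ?_
  obtain ⟨s', hs', hv'⟩ := List.mem_flatMap.1 hv'
  obtain rfl : s = s' := hT.eq_of_id_eq hs hs' (hf _ _ _ _ hv')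
  exact huniq v' hv'

theorem zeroDummy (hT : IsQuantumRangeTree b D T) : (T.memory b).ZeroDummy where
  hierarchy j := by
    refine QRAM.ofStores_eq_zero fun r hr h => ?_
    rw [RangeTree.collect_eq] at hr
    obtain ⟨s, hs, hr⟩ := List.mem_flatMap.1 hr
    exact hT.id_ne_zero hs ((fst_of_mem_childStores hr).symm.trans (by rw [h]))
  data j := by
    refine QRAM.ofStores_eq_zero fun r hr h => ?_
    rw [RangeTree.collect_eq] at hr
    obtain ⟨s, hs, hr⟩ := List.mem_flatMap.1 hr
    exact hT.id_ne_zero hs ((fst_of_mem_dataStores hr).symm.trans (by rw [h]))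

theorem represents (hT : IsQuantumRangeTree b D T) {m h : ℕ}
    {v : Node d nk nr w (RangeTree d nk nr w m) h} (hv : ⟨m, h, v⟩ ∈ T.nodes d) :
    Represents (T.memory b) v := by
  induction h with
  | zero =>
    refine ⟨hT.id_ne_zero hv, (hT.isFor.wellFormed hv).1, fun j => ⟨?_, ?_⟩⟩
    · refine hT.ofStores_collect (fun _ _ _ _ => fst_of_mem_childStores) hv ?_ ?_
      · exact List.mem_map.2 ⟨j, mem_indices j, rfl⟩
      · intro v' hv'
        obtain ⟨j', -, hj'⟩ := List.mem_map.1 hv'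
        cases hj'
        rfl
    · refine hT.ofStores_collect (fun _ _ _ _ => fst_of_mem_dataStores) hv ?_ ?_
      · exact List.mem_map.2 ⟨j, mem_indices j, rfl⟩
      · intro v' hv'
        obtain ⟨j', -, hj'⟩ := List.mem_map.1 hv'
        cases hj'
        rfl
  | succ h ih =>
    have hier : ∀ j : BitVec b, (T.memory b).hierarchy (v.id, j) =
        (v.children[j.toNat]?.map Node.id).getD 0 := by
      intro j
      refine hT.ofStores_collect (fun _ _ _ _ => fst_of_mem_childStores) hv ?_ ?_
      · exact List.mem_map.2 ⟨j, mem_indices j, rfl⟩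
      · intro v' hv'
        obtain ⟨j', -, hj'⟩ := List.mem_map.1 hv'
        cases hj'
        rfl
    refine ⟨hT.id_ne_zero hv, (hT.isFor.wellFormed hv).1, ?_, hier,
      fun c hc => ih (RangeTree.child_mem_nodes hv hc)⟩
    rw [hier]
    cases hc : v.children[(0 : BitVec b).toNat]? with
    | none => exact (hT.id_ne_zero hv).symm
    | some c =>
      intro h0
      have := hT.eq_of_id_eq (RangeTree.child_mem_nodes hv (List.mem_of_getElem? hc)) hv h0
      have := congrArg (fun s : SNode d nk nr w => s.2.1) this
      simp at this

theorem slots_eq_some (hT : IsQuantumRangeTree b D T) {v : SNode d nk nr w}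
    (hv : v ∈ T.nodes d) {s : Pair d nk nr × List (BitVec b) × BitVec b}
    (hs : s ∈ v.2.2.slots b) (huniq : ∀ s' ∈ v.2.2.slots b, s'.1 = s.1 → s' = s) :
    (T.memory b).slots (v.id, s.1) = some s.2 := by
  refine hT.ofStores_collect (fun _ _ _ _ => fst_of_mem_slotStores) hv ?_ ?_
  · exact List.mem_map.2 ⟨s, hs, rfl⟩
  · intro v' hv'
    obtain ⟨s', hs', h⟩ := List.mem_map.1 hv'
    simp only [Prod.mk.injEq] at h
    rw [← h.2, huniq s' hs' h.1.2]

theorem slots_eq_none (hT : IsQuantumRangeTree b D T) {v : SNode d nk nr w}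
    (hv : v ∈ T.nodes d) {p : Pair d nk nr} (hp : p ∉ v.pairs) :
    (T.memory b).slots (v.id, p) = none := by
  refine QRAM.ofStores_eq_zero fun r hr h => ?_
  rw [RangeTree.collect_eq] at hr
  obtain ⟨v', hv', hr⟩ := List.mem_flatMap.1 hr
  obtain rfl : v' = v :=
    hT.eq_of_id_eq hv' hv ((fst_of_mem_slotStores hr).symm.trans (by rw [h]))
  obtain ⟨s, hs, rfl⟩ := List.mem_map.1 hr
  simp only [Prod.mk.injEq] at h
  exact hp (h.2 ▸ Node.mem_pairs_of_mem_slots hs)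

end IsQuantumRangeTree

end Memory

/-! ### Circuits as linear maps -/

section Circuit

variable {d nk nr w b : ℕ}

/-- The linear map that a circuit defines on superpositions. -/
noncomputable def circuitMap (M : Memory d nk nr w b) (x y : Key d nk) :
    List (Gate w) → State d nk nr w b →ₗ[ℂ] State d nk nr w b
  | [] => LinearMap.id
  | g :: l => circuitMap M x y l ∘ₗ Finsupp.linearCombination ℂ fun c => g.onBasis M x y c

theorem runCircuit_eq (M : Memory d nk nr w b) (x y : Key d nk) (l : List (Gate w))
    (ψ : State d nk nr w b) : runCircuit M x y l ψ = circuitMap M x y l ψ := by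
  induction l generalizing ψ with
  | nil => rfl
  | cons g l ih => exact ih _

theorem circuitMap_cons_single (M : Memory d nk nr w b) (x y : Key d nk) (g : Gate w)
    (l : List (Gate w)) (c : Config d nk nr w b) :
    circuitMap M x y (g :: l) (Finsupp.single c 1) =
      circuitMap M x y l (g.onBasis M x y c) := by
  simp [circuitMap]

theorem circuitMap_append (M : Memory d nk nr w b) (x y : Key d nk) (l l' : List (Gate w))
    (ψ : State d nk nr w b) :
    circuitMap M x y (l ++ l') ψ = circuitMap M x y l' (circuitMap M x y l ψ) := by
  induction l generalizing ψ with
  | nil => rfl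
  | cons g l ih => exact ih _

/-- The projection onto the control qubit being `1`, as a linear map. -/
noncomputable def flaggedMap (d nk nr w b : ℕ) :
    State d nk nr w b →ₗ[ℂ] State d nk nr w b where
  toFun := flagged
  map_add' _ _ := Finsupp.filter_add
  map_smul' _ _ := Finsupp.filter_smul

theorem flaggedMap_apply (ψ : State d nk nr w b) : flaggedMap d nk nr w b ψ = flagged ψ := rfl

theorem flaggedMap_single (c : Config d nk nr w b) :
    flaggedMap d nk nr w b (Finsupp.single c 1) =
      if c.flag = true then Finsupp.single c 1 else 0 := by
  rw [flaggedMap_apply, flagged]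
  split_ifs with h
  · exact Finsupp.filter_single_of_pos _ h
  · exact Finsupp.filter_single_of_neg _ h

/-- The amplitude `1 / √B` of each value of an index register after Hadamard gates. -/
noncomputable def spreadAmp (b : ℕ) : ℂ := ((1 / √((2 : ℝ) ^ b) : ℝ) : ℂ)

theorem hadamard_eq (t : ℕ) (c : Config d nk nr w b) (h : c.idx t = 0) :
    hadamard t c = ∑ j : BitVec b,
      spreadAmp b • Finsupp.single { c with idx := Function.update c.idx t j } 1 := by
  simp [hadamard, h, dotSign, spreadAmp]

theorem DataWord.dummy_xor (p : DataWord d nk nr) : DataWord.dummy d nk nr ^^^ p = p := by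
  ext1
  all_goals first
    | exact BitVec.zero_xor
    | (funext j; exact BitVec.zero_xor)

end Circuit

/-! ### The walk to the pairs below a node -/

section Walk

variable {d nk nr w b : ℕ}

/-- The node reached from `u` after `r` loads from the hierarchy memory along the edges `f`. -/
def trace (M : Memory d nk nr w b) (u : BitVec w) (f : ℕ → BitVec b) : ℕ → BitVec w
  | 0 => u
  | r + 1 => M.hierarchy (trace M u f r, f r)

theorem trace_update (M : Memory d nk nr w b) (u : BitVec w) (f : ℕ → BitVec b) {t r : ℕ}
    (h : r ≤ t) (j : BitVec b) : trace M u (Function.update f t j) r = trace M u f r := by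
  induction r with
  | zero => rfl
  | succ r ih =>
    rw [trace, trace, ih (by omega), Function.update_of_ne (by omega)]

/-- The basis state in which the walk from `u` along the edges `f` has reached level `t`. -/
def walkConfig (M : Memory d nk nr w b) (u : BitVec w) (t : ℕ) (f : ℕ → BitVec b)
    (p : DataWord d nk nr) (flag : Bool) : Config d nk nr w b :=
  ⟨fun r => if r ≤ t then trace M u f r else 0, f, p, flag⟩

theorem walkConfig_node (M : Memory d nk nr w b) (u : BitVec w) (t : ℕ) (f : ℕ → BitVec b)
    (p : DataWord d nk nr) (flag : Bool) :
    (walkConfig M u t f p flag).node t = trace M u f t := by simp [walkConfig]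

theorem walkConfig_update (M : Memory d nk nr w b) (u : BitVec w) (t : ℕ) (f : ℕ → BitVec b)
    (p : DataWord d nk nr) (flag : Bool) (j : BitVec b) :
    { walkConfig M u t f p flag with idx := Function.update f t j } =
      walkConfig M u t (Function.update f t j) p flag := by
  ext1
  · funext r
    simp only [walkConfig]
    split_ifs with h
    · rw [trace_update M u f h]
    · rfl
  all_goals rfl

variable (M : Memory d nk nr w b) (x y : Key d nk)

theorem onBasis_loadChild (u : BitVec w) (t : ℕ) (f : ℕ → BitVec b)
    (p : DataWord d nk nr) (flag : Bool) :
    (Gate.loadChild t).onBasis M x y (walkConfig M u t f p flag) =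
      Finsupp.single (walkConfig M u (t + 1) f p flag) 1 := by
  simp only [Gate.onBasis]
  congr 1
  ext1
  · funext r
    simp only [walkConfig, QRAM.load]
    rcases lt_trichotomy r (t + 1) with h | rfl | h
    · rw [Function.update_of_ne (by omega), if_pos (by omega), if_pos (by omega)]
    · simp [trace]
    · rw [Function.update_of_ne (by omega), if_neg (by omega), if_neg (by omega)]
  all_goals rfl

/-- Loading a child a second time resets its register. -/
theorem onBasis_loadChild_inverse (u : BitVec w) (t : ℕ) (f : ℕ → BitVec b)
    (p : DataWord d nk nr) (flag : Bool) :
    (Gate.loadChild t).onBasis M x y (walkConfig M u (t + 1) f p flag) =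
      Finsupp.single (walkConfig M u t f p flag) 1 := by
  simp only [Gate.onBasis]
  congr 1
  ext1
  · funext r
    simp only [walkConfig, QRAM.load]
    rcases lt_trichotomy r (t + 1) with h | rfl | h
    · rw [Function.update_of_ne (by omega), if_pos (by omega), if_pos (by omega)]
    · simp [trace]
    · rw [Function.update_of_ne (by omega), if_neg (by omega), if_neg (by omega)]
  all_goals rfl

/-- The walk from level `t` on, with `m` levels to go. -/
def walkFrom (w : ℕ) : ℕ → ℕ → List (Gate w)
  | t, 0 => [.spread t, .loadData t, .mark]
  | t, m + 1 => .branch t :: .loadChild t :: walkFrom w (t + 1) m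

theorem walkCircuit_eq (w H : ℕ) : walkCircuit w H = walkFrom w 0 H := by
  have key : ∀ m t, (List.range' t m).flatMap (fun t => [.branch t, .loadChild t]) ++
      [.spread (t + m), .loadData (t + m), .mark] = walkFrom w t m := by
    intro m
    induction m with
    | zero => intro t; rfl
    | succ m ih =>
      intro t
      rw [walkFrom, ← ih (t + 1), show t + 1 + m = t + (m + 1) by omega]
      rfl
  rw [← key, Nat.zero_add, walkCircuit, List.range_eq_range']

theorem not_atLeaf_of_zero {t : ℕ} {c : Config d nk nr w b} (h : c.node t = 0) :
    ¬ AtLeaf M t c := fun h' => h'.1 h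

/-- One level of the walk at a node that is not a leaf. -/
theorem circuitMap_branch {u : BitVec w} {t : ℕ} {f : ℕ → BitVec b} {p : DataWord d nk nr}
    {flag : Bool} (l : List (Gate w)) (hf : f t = 0)
    (hleaf : ¬ AtLeaf M t (walkConfig M u t f p flag)) :
    circuitMap M x y (.branch t :: .loadChild t :: l)
        (Finsupp.single (walkConfig M u t f p flag) 1) =
      ∑ j : BitVec b, spreadAmp b • circuitMap M x y l
        (Finsupp.single (walkConfig M u (t + 1) (Function.update f t j) p flag) 1) := by
  rw [circuitMap_cons_single, Gate.onBasis, if_neg hleaf, hadamard_eq _ _ hf, map_sum]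
  refine Finset.sum_congr rfl fun j _ => ?_
  rw [map_smul]
  change _ • circuitMap M x y _
    (Finsupp.single { walkConfig M u t f p flag with idx := Function.update f t j } 1) = _
  rw [walkConfig_update, circuitMap_cons_single, onBasis_loadChild]

/-- One level of the walk at a leaf. -/
theorem circuitMap_branch_leaf {u : BitVec w} {t : ℕ} {f : ℕ → BitVec b}
    {p : DataWord d nk nr} {flag : Bool} (l : List (Gate w))
    (hleaf : AtLeaf M t (walkConfig M u t f p flag)) :
    circuitMap M x y (.branch t :: .loadChild t :: l)
        (Finsupp.single (walkConfig M u t f p flag) 1) =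
      circuitMap M x y l (Finsupp.single (walkConfig M u (t + 1) f p flag) 1) := by
  rw [circuitMap_cons_single, Gate.onBasis, if_pos hleaf, circuitMap_cons_single,
    onBasis_loadChild]

/-- The last level of the walk: all slots of the node reached are read and tested. -/
theorem flagged_circuitMap_spread {u : BitVec w} {t : ℕ} {f : ℕ → BitVec b} (hf : f t = 0) :
    flaggedMap d nk nr w b (circuitMap M x y [.spread t, .loadData t, .mark]
        (Finsupp.single (walkConfig M u t f (.dummy d nk nr) false) 1)) =
      ∑ j : BitVec b, spreadAmp b •
        if (M.data (trace M u f t, j)).tag = 2 ∧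
            InRange x y (M.data (trace M u f t, j)).key then
          Finsupp.single (walkConfig M u t (Function.update f t j)
            (M.data (trace M u f t, j)) true) 1
        else 0 := by
  rw [circuitMap_cons_single, Gate.onBasis, hadamard_eq _ _ hf, map_sum, map_sum]
  refine Finset.sum_congr rfl fun j _ => ?_
  rw [map_smul, map_smul]
  change _ • flaggedMap d nk nr w b (circuitMap M x y _
    (Finsupp.single { walkConfig M u t f _ _ with idx := Function.update f t j } 1)) = _
  congr 1
  rw [walkConfig_update, circuitMap_cons_single, Gate.onBasis, circuitMap_cons_single,
    Gate.onBasis]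
  simp only [walkConfig, le_refl, if_true, Function.update_self, QRAM.load, Bool.false_xor,
    DataWord.dummy_xor, trace_update]
  rw [circuitMap, LinearMap.id_apply, flaggedMap_single]
  simp only [decide_eq_true_eq]
  split_ifs with h
  · simp [h]
  · rfl

/-- A walk that has run into `dummy` never raises the control qubit. -/
theorem flagged_walkFrom_dummy (hM : M.ZeroDummy) {u : BitVec w} {t m : ℕ} {f : ℕ → BitVec b}
    (hu : trace M u f t = 0) (hf : ∀ r, t ≤ r → f r = 0) :
    flaggedMap d nk nr w b (circuitMap M x y (walkFrom w t m)
      (Finsupp.single (walkConfig M u t f (.dummy d nk nr) false) 1)) = 0 := by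
  induction m generalizing t f with
  | zero =>
    rw [walkFrom, flagged_circuitMap_spread M x y (hf t le_rfl)]
    refine Finset.sum_eq_zero fun j _ => ?_
    rw [if_neg, smul_zero]
    rw [hu, hM.data]
    simp [DataWord.dummy]
  | succ m ih =>
    rw [walkFrom, circuitMap_branch M x y _ (hf t le_rfl)
      (not_atLeaf_of_zero M ((walkConfig_node ..).trans hu)), map_sum]
    refine Finset.sum_eq_zero fun j _ => ?_
    rw [map_smul, ih, smul_zero]
    · rw [trace, trace_update M u f le_rfl, hu, hM.hierarchy]
    · intro r hr
      rw [Function.update_of_ne (by omega), hf r (by omega)]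

/-- The edge-index registers at the end of a walk that, after the edges `f` down to level `t`,
has gone to the slot `s` below the node reached, the position in the leaf being in
register `H`. -/
def slotIdx (H t : ℕ) (f : ℕ → BitVec b) (s : List (BitVec b) × BitVec b) : ℕ → BitVec b :=
  fun r => if r < t then f r else if r = H then s.2 else s.1.getD (r - t) 0

theorem sum_getElem?_eq {α N : Type} [AddCommMonoid N] (l : List α) (G : ℕ → α → N) (n k : ℕ)
    (h : l.length ≤ n) :
    ∑ i ∈ Finset.range n, l[i]?.elim 0 (G (i + k)) =
      ((l.zipIdx k).map fun s => G s.2 s.1).sum := by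
  induction l generalizing n k with
  | nil => simp
  | cons a l ih =>
    obtain ⟨n, rfl⟩ : ∃ m, n = m + 1 := ⟨n - 1, by simp at h; omega⟩
    rw [Finset.sum_range_succ', List.zipIdx_cons, List.map_cons, List.sum_cons,
      ← ih n (k + 1) (by simpa using h), add_comm]
    simp [add_assoc, add_comm 1 k]

/-- A sum over all values of an index register, in which only the places of a list count. -/
theorem sum_bitVec_getElem? {α N : Type} [AddCommMonoid N] (l : List α) (G : BitVec b → α → N)
    (h : l.length ≤ 2 ^ b) :
    ∑ j : BitVec b, l[j.toNat]?.elim 0 (G j) =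
      (l.zipIdx.map fun s => G (BitVec.ofNat b s.2) s.1).sum := by
  rw [← sum_getElem?_eq l (fun i => G (BitVec.ofNat b i)) (2 ^ b) 0 h]
  refine Finset.sum_bij' (fun j _ => j.toNat) (fun i _ => BitVec.ofNat b i) ?_ ?_ ?_ ?_ ?_
  · intro j _
    simpa using j.isLt
  · simp
  · simp
  · intro i hi
    simpa using Nat.mod_eq_of_lt (Finset.mem_range.1 hi)
  · simp

end Walk

section Walk

variable {d nk nr w b : ℕ}

/-- The contribution of the slot `s` below a node of height `h`, reached at level `t`, to the
flagged part of the walk. -/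
noncomputable def slotTerm (M : Memory d nk nr w b) (x y : Key d nk) (u : BitVec w)
    (H t h : ℕ) (f : ℕ → BitVec b) (s : Pair d nk nr × List (BitVec b) × BitVec b) :
    State d nk nr w b :=
  if InRange x y s.1.1 then
    spreadAmp b ^ (h + 1) •
      Finsupp.single (walkConfig M u H (slotIdx H t f s.2) (.ofPair s.1) true) 1
  else 0

theorem slotIdx_leaf {t : ℕ} {f : ℕ → BitVec b} (hf : ∀ r, t ≤ r → f r = 0) (j : BitVec b) :
    slotIdx t t f ([], j) = Function.update f t j := by
  funext r
  simp only [slotIdx]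
  rcases lt_trichotomy r t with h | rfl | h
  · rw [if_pos h, Function.update_of_ne h.ne]
  · simp
  · rw [if_neg (by omega), if_neg h.ne', Function.update_of_ne h.ne', hf r h.le]
    simp

theorem slotIdx_leaf_succ {H t : ℕ} {f : ℕ → BitVec b} (ht : t < H) (hf : f t = 0)
    (j : BitVec b) : slotIdx H (t + 1) f ([], j) = slotIdx H t f ([], j) := by
  funext r
  simp only [slotIdx]
  rcases lt_trichotomy r t with h | rfl | h
  · rw [if_pos h, if_pos (by omega)]
  · rw [if_pos (by omega), if_neg (by omega), if_neg (by omega)]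
    simpa using hf
  · rw [if_neg (show ¬ r < t + 1 by omega), if_neg (show ¬ r < t by omega)]
    simp

theorem slotIdx_inner {H t : ℕ} (f : ℕ → BitVec b) (ht : t < H) (j k : BitVec b)
    (l : List (BitVec b)) :
    slotIdx H (t + 1) (Function.update f t j) (l, k) = slotIdx H t f (j :: l, k) := by
  funext r
  simp only [slotIdx]
  rcases lt_trichotomy r t with h | rfl | h
  · rw [if_pos h, if_pos (by omega), Function.update_of_ne h.ne]
  · rw [if_pos (by omega), if_neg (by omega), if_neg (by omega)]
    simp
  · rw [if_neg (show ¬ r < t + 1 by omega), if_neg (show ¬ r < t by omega),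
      show r - t = (r - (t + 1)) + 1 by omega]
    simp

/-- The walk from a node reaches every slot below it, whatever its depth, with the amplitude
`B ^ (-(h + 1) / 2)`: each of the `h` edge indices and the position in the leaf contributes a
factor `B ^ (-1 / 2)`. -/
theorem flagged_walkFrom {M : Memory d nk nr w b} (hM : M.ZeroDummy) (x y : Key d nk) {A : Type}
    {h m t H : ℕ} {v : Node d nk nr w A h} (hv : Represents M v) (hm : h ≤ m) (hH : t + m = H)
    {u : BitVec w} {f : ℕ → BitVec b} (hu : trace M u f t = v.id)
    (hf : ∀ r, t ≤ r → f r = 0) :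
    flaggedMap d nk nr w b (circuitMap M x y (walkFrom w t m)
      (Finsupp.single (walkConfig M u t f (.dummy d nk nr) false) 1)) =
    ((v.slots b).map (slotTerm M x y u H t h f)).sum := by
  induction m generalizing h t f with
  | zero =>
    obtain rfl : h = 0 := by omega
    obtain rfl : t = H := by omega
    obtain ⟨-, hlen, hdata⟩ := hv
    rw [walkFrom, flagged_circuitMap_spread M x y (hf t le_rfl), hu, Node.slots, List.map_map]
    refine Eq.trans ?_
      (sum_bitVec_getElem? _ (fun j p => slotTerm M x y u t t 0 f (p, [], j)) hlen)
    refine Finset.sum_congr rfl fun j _ => ?_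
    have hd := (hdata j).2
    change M.data (Node.id (A := A) (h := 0) v, j) = _ at hd
    rw [hd]
    cases (Leaf.pairs v)[j.toNat]? with
    | none => simp [DataWord.dummy]
    | some p => simp [slotTerm, slotIdx_leaf hf, DataWord.ofPair]
  | succ m ih =>
    cases h with
    | zero =>
      have hleaf : AtLeaf M t (walkConfig M u t f (.dummy d nk nr) false) := by
        rw [AtLeaf, walkConfig_node, hu]
        exact ⟨hv.1, (hv.2.2 0).1⟩
      rw [walkFrom, circuitMap_branch_leaf M x y _ hleaf,
        ih hv (Nat.zero_le m) (by omega) ?_ fun r hr => hf r (by omega)]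
      · congr 1
        refine List.map_congr_left fun s hs => ?_
        have : s.2 = ([], s.2.2) :=
          Prod.ext (List.length_eq_zero_iff.1 (Node.length_of_mem_slots hs)) rfl
        rw [slotTerm, slotTerm, this, slotIdx_leaf_succ (by omega) (hf t le_rfl)]
      · rw [trace, hu]
        exact (hv.2.2 _).1
    | succ h =>
      obtain ⟨-, hlen, hne, hier, hch⟩ := hv
      have hleaf : ¬ AtLeaf M t (walkConfig M u t f (.dummy d nk nr) false) := by
        rw [AtLeaf, walkConfig_node, hu]
        exact fun h' => hne h'.2
      have htr : ∀ j, trace M u (Function.update f t j) (t + 1) =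
          (v.children[j.toNat]?.map Node.id).getD 0 := by
        intro j
        rw [trace, trace_update M u f le_rfl, hu, Function.update_self, hier]
      have hf' : ∀ j, ∀ r, t + 1 ≤ r → Function.update f t j r = 0 := fun j r hr => by
        rw [Function.update_of_ne (by omega), hf r (by omega)]
      rw [walkFrom, circuitMap_branch M x y _ (hf t le_rfl) hleaf, map_sum, Node.slots,
        List.map_flatMap, List.flatMap_def, List.sum_flatten, List.map_map]
      refine Eq.trans ?_ ((sum_bitVec_getElem? _
        (fun j c => ((c.slots b).map fun r =>
          slotTerm M x y u H t (h + 1) f (r.1, j :: r.2.1, r.2.2)).sum) hlen).trans ?_)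
      rotate_left
      · simp only [Function.comp_def, List.map_map]
      refine Finset.sum_congr rfl fun j _ => ?_
      rw [map_smul]
      have hj := htr j
      cases hc : v.children[j.toNat]? with
      | none =>
        rw [hc] at hj
        rw [flagged_walkFrom_dummy M x y hM hj (hf' j), smul_zero]
        rfl
      | some c =>
        rw [hc] at hj
        rw [ih (hch c (List.mem_of_getElem? hc)) (by omega) (by omega) hj (hf' j),
          List.smul_sum, List.map_map, Option.elim_some]
        congr 1
        refine List.map_congr_left fun s _ => ?_
        simp only [Function.comp, slotTerm, smul_ite, smul_zero, smul_smul,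
          slotIdx_inner f (show t < H by omega), ← pow_succ']


end Walk

/-! ### The state returned by the query -/

theorem sqrt_pow_eq {a : ℝ} (ha : 0 ≤ a) (n : ℕ) : √(a ^ n) = √a ^ n := by
  rw [Real.sqrt_eq_iff_mul_self_eq (by positivity) (by positivity), ← mul_pow,
    Real.mul_self_sqrt ha]

theorem le_topHeight {w : ℕ} {L : List (BitVec w × ℕ)} {u : BitVec w × ℕ} (hu : u ∈ L) :
    u.2 ≤ topHeight L := by
  induction L with
  | nil => simp at hu
  | cons a L ih =>
    simp only [topHeight, List.map_cons, List.foldr_cons]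
    rcases List.mem_cons.1 hu with rfl | h
    · exact le_max_left _ _
    · exact (ih h).trans (le_max_right _ _)

theorem sum_norm_sq_smul_sum_single {κ : Type} {l : List κ} (hl : l.Nodup) (a : ℂ) :
    (a • (l.map fun c => Finsupp.single c (1 : ℂ)).sum).sum (fun _ z => ‖z‖ ^ 2) =
      l.length * ‖a‖ ^ 2 := by
  classical
  rw [← List.sum_toFinset _ hl]
  have happ : ∀ c, (a • ∑ c ∈ l.toFinset, Finsupp.single c (1 : ℂ)) c =
      if c ∈ l.toFinset then a else 0 := by
    intro c
    rw [Finsupp.smul_apply, Finsupp.finsetSum_apply]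
    simp [Finsupp.single_apply]
  rw [Finsupp.sum_of_support_subset _ (s := l.toFinset)]
  · rw [Finset.sum_congr rfl fun c hc => by rw [happ c, if_pos hc], Finset.sum_const,
      List.toFinset_card_of_nodup hl, nsmul_eq_mul]
  · intro c hc
    by_contra h
    rw [Finsupp.mem_support_iff, happ, if_neg h] at hc
    exact hc rfl
  · simp

section Answer

variable {d nk nr w b : ℕ}

/-- The candidate list (identifiers and heights) of a list of nodes. -/
def candList (Cs : List (SNode d nk nr w)) : List (BitVec w × ℕ) :=
  Cs.map fun v => (v.id, v.height)

/-- The slots below the nodes `Cs` that hold an answer, with the node they are found from. -/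
def hits (b : ℕ) (x y : Key d nk) (Cs : List (SNode d nk nr w)) :
    List (SNode d nk nr w × Pair d nk nr × List (BitVec b) × BitVec b) :=
  Cs.flatMap fun v =>
    ((v.2.2.slots b).filter fun s => InRange x y s.1.1).map fun s => (v, s)

theorem map_hits (x y : Key d nk) (Cs : List (SNode d nk nr w)) :
    (hits b x y Cs).map (fun s => s.2.1) =
      (Cs.flatMap SNode.pairs).filter fun p => InRange x y p.1 := by
  rw [hits, List.map_flatMap, List.filter_flatMap]
  congr 1
  funext v
  rw [List.map_map, SNode.pairs, ← Node.map_fst_slots (b := b), List.filter_map]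
  rfl

/-- The basis state that the walk ends in when it starts at the node `s.1` and ends in the
slot `s.2`. -/
def hitConfig (M : Memory d nk nr w b) (H : ℕ)
    (s : SNode d nk nr w × Pair d nk nr × List (BitVec b) × BitVec b) : Config d nk nr w b :=
  walkConfig M s.1.id H (slotIdx H 0 (fun _ => 0) s.2.2) (.ofPair s.2.1) true

theorem DataWord.ofPair_injective {p q : Pair d nk nr} (h : DataWord.ofPair p = .ofPair q) :
    p = q :=
  Prod.ext (congrArg DataWord.key h) (congrArg DataWord.record h)

theorem prepare_eq (M : Memory d nk nr w b) (Cs : List (SNode d nk nr w)) :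
    prepare d nk nr b (candList Cs) = (Cs.map fun v =>
      ((√(((2 : ℝ) ^ b) ^ (v.height + 1) /
        (Cs.map fun v => ((2 : ℝ) ^ b) ^ (v.height + 1)).sum) : ℝ) : ℂ) •
      Finsupp.single (walkConfig M v.id 0 (fun _ => 0) (.dummy d nk nr) false) 1).sum := by
  rw [prepare, candList, List.map_map, List.map_map]
  congr 1
  refine List.map_congr_left fun v _ => ?_
  rw [Finsupp.smul_single, smul_eq_mul, mul_one]
  simp only [Function.comp]
  congr 1
  ext1
  · funext r
    rcases r with _ | r <;> simp [walkConfig, trace]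
  all_goals rfl

/-- All slots with an answer have the same amplitude `1 / √S` at the end of the walk: the
amplitude `√(B ^ (h + 1) / S)` of a candidate of height `h` makes up for the factor
`B ^ (-(h + 1) / 2)` of the walk. -/
theorem flagged_walkState {M : Memory d nk nr w b} (hM : M.ZeroDummy) (x y : Key d nk)
    {Cs : List (SNode d nk nr w)} (hCs : ∀ v ∈ Cs, Represents M v.2.2) :
    flagged (walkState M x y (candList Cs)) =
      ((1 / √((Cs.map fun v => ((2 : ℝ) ^ b) ^ (v.height + 1)).sum) : ℝ) : ℂ) •
        ((hits b x y Cs).map fun s =>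
          Finsupp.single (hitConfig M (topHeight (candList Cs)) s) 1).sum := by
  rw [walkState, runCircuit_eq, walkCircuit_eq, prepare_eq M, map_list_sum, ← flaggedMap_apply,
    map_list_sum, List.map_map, List.map_map, hits, List.map_flatMap, List.flatMap_def,
    List.sum_flatten, List.map_map, List.smul_sum, List.map_map]
  congr 1
  refine List.map_congr_left fun v hv => ?_
  have hle : v.height ≤ topHeight (candList Cs) :=
    le_topHeight (List.mem_map_of_mem (f := fun v : SNode d nk nr w => (v.id, v.height)) hv)
  simp only [Function.comp, map_smul]
  have hwalk := flagged_walkFrom hM x y (hCs v hv) hle (Nat.zero_add _) (u := v.id)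
    (f := fun _ => 0) rfl fun _ _ => rfl
  rw [hwalk, List.map_map, List.smul_sum, List.smul_sum, List.map_map, List.map_map]
  have hamp : ((√(((2 : ℝ) ^ b) ^ (v.height + 1) /
      (Cs.map fun v => ((2 : ℝ) ^ b) ^ (v.height + 1)).sum) : ℝ) : ℂ) *
        spreadAmp b ^ (v.height + 1) =
      ((1 / √((Cs.map fun v => ((2 : ℝ) ^ b) ^ (v.height + 1)).sum) : ℝ) : ℂ) := by
    rw [spreadAmp, ← Complex.ofReal_pow, ← Complex.ofReal_mul, Real.sqrt_div (by positivity),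
      sqrt_pow_eq (by positivity)]
    congr 1
    have : √((2 : ℝ) ^ b) ≠ 0 := by positivity
    rw [one_div, inv_pow, div_mul_eq_mul_div, mul_inv_cancel₀ (pow_ne_zero _ this)]
  generalize v.2.2.slots b = l
  induction l with
  | nil => rfl
  | cons s l ih =>
    rw [List.map_cons, List.sum_cons, ih, List.filter_cons]
    by_cases hs : InRange x y s.1.1
    · simp only [hs, decide_true, if_true, List.map_cons, List.sum_cons, Function.comp]
      congr 1
      rw [slotTerm, if_pos hs, smul_smul]
      change (_ * spreadAmp b ^ (v.height + 1)) • _ = _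
      rw [hamp]
      rfl
    · simp [slotTerm, hs]

theorem circuitMap_loadChild_reverse (M : Memory d nk nr w b) (x y : Key d nk) (u : BitVec w)
    (H : ℕ) (f : ℕ → BitVec b) (p : DataWord d nk nr) (flag : Bool) :
    circuitMap M x y ((List.range H).reverse.map .loadChild)
      (Finsupp.single (walkConfig M u H f p flag) 1) =
      Finsupp.single (walkConfig M u 0 f p flag) 1 := by
  induction H with
  | zero => rfl
  | succ H ih =>
    rw [List.range_succ, List.reverse_append, List.reverse_singleton, List.singleton_append,
      List.map_cons, circuitMap_cons_single, onBasis_loadChild_inverse, ih]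

theorem circuitMap_erase_of_none {M : Memory d nk nr w b} (x y : Key d nk) (H : ℕ)
    {us : List (BitVec w)} {c : Config d nk nr w b}
    (h : ∀ u ∈ us, M.slots (u, (c.data.key, c.data.record)) = none) :
    circuitMap M x y (us.map fun u => .erase H u) (Finsupp.single c 1) =
      Finsupp.single c 1 := by
  induction us with
  | nil => rfl
  | cons u us ih =>
    rw [List.map_cons, circuitMap_cons_single, Gate.onBasis, h u List.mem_cons_self]
    exact ih fun u' hu' => h u' (List.mem_cons_of_mem _ hu')

theorem onBasis_erase {M : Memory d nk nr w b} (x y : Key d nk) {H : ℕ} {u : BitVec w}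
    {p : Pair d nk nr} {s : List (BitVec b) × BitVec b} (h : M.slots (u, p) = some s) :
    (Gate.erase H u).onBasis M x y
      (walkConfig M u 0 (slotIdx H 0 (fun _ => 0) s) (.ofPair p) true) =
      Finsupp.single (output w b p) 1 := by
  simp only [Gate.onBasis]
  have h' : M.slots (u, (DataWord.ofPair p).key, (DataWord.ofPair p).record) = some s := h
  simp only [walkConfig, h']
  congr 1
  ext1
  · funext r
    rcases r with _ | r <;> simp [trace, output]
  · funext r
    simp [slotIdx, output]
  all_goals rfl

/-- Resetting the address registers. As the answers are distinct, each one is found below exactly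
one candidate, and only the `erase` gate of that candidate acts. -/
theorem circuitMap_reset {D : Finset (Pair d nk nr)} {T : RangeTree d nk nr w d}
    (hT : IsQuantumRangeTree b D T) (x y : Key d nk) {Cs : List (SNode d nk nr w)}
    (hCs : ∀ v ∈ Cs, v ∈ T.nodes d)
    (hnd : ((Cs.flatMap SNode.pairs).filter fun p => InRange x y p.1).Nodup) (H : ℕ)
    {s : SNode d nk nr w × Pair d nk nr × List (BitVec b) × BitVec b}
    (hs : s ∈ hits b x y Cs) :
    circuitMap (T.memory b) x y (resetCircuit H (candList Cs))
      (Finsupp.single (hitConfig (T.memory b) H s) 1) =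
      Finsupp.single (output w b s.2.1) 1 := by
  obtain ⟨v, hv, hsv⟩ := List.mem_flatMap.1 hs
  obtain ⟨s, hsf, rfl⟩ := List.mem_map.1 hsv
  clear hs
  obtain ⟨hs, hr⟩ := List.mem_filter.1 hsf
  have hp := Node.mem_pairs_of_mem_slots hs
  have hlook := hT.slots_eq_some (hCs v hv) hs
  obtain ⟨A, B, rfl⟩ := List.append_of_mem hv
  simp only [List.flatMap_append, List.flatMap_cons, List.filter_append] at hnd
  have hpv : s.1 ∈ v.pairs.filter fun p => InRange x y p.1 := List.mem_filter.2 ⟨hp, hr⟩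
  have hA : ∀ v' ∈ A, s.1 ∉ v'.pairs := fun v' hv' h' =>
    List.disjoint_of_nodup_append hnd
      (List.mem_filter.2 ⟨List.mem_flatMap.2 ⟨v', hv', h'⟩, hr⟩)
      (List.mem_append_left _ hpv)
  have hB : ∀ v' ∈ B, s.1 ∉ v'.pairs := fun v' hv' h' =>
    List.disjoint_of_nodup_append hnd.of_append_right hpv
      (List.mem_filter.2 ⟨List.mem_flatMap.2 ⟨v', hv', h'⟩, hr⟩)
  have hnv : (((v.2.2.slots b).filter fun s => InRange x y s.1.1).map Prod.fst).Nodup := by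
    have := hnd.of_append_right.of_append_left
    rw [SNode.pairs, ← Node.map_fst_slots (b := b), List.filter_map] at this
    exact this
  have hsome : (T.memory b).slots (v.id, s.1) = some s.2 := by
    refine hlook fun s' hs' h => ?_
    refine List.inj_on_of_nodup_map hnv (List.mem_filter.2 ⟨hs', ?_⟩)
      (List.mem_filter.2 ⟨hs, hr⟩) h
    rw [h]
    exact hr
  have hreset : resetCircuit H (candList (A ++ v :: B)) =
      (List.range H).reverse.map .loadChild ++ ((A.map SNode.id).map (fun u => .erase H u) ++
        (.erase H v.id :: (B.map SNode.id).map fun u => .erase H u)) := by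
    simp [resetCircuit, candList, Function.comp_def]
  rw [hreset, circuitMap_append, hitConfig, circuitMap_loadChild_reverse, circuitMap_append,
    circuitMap_erase_of_none, circuitMap_cons_single, onBasis_erase x y hsome,
    circuitMap_erase_of_none]
  · intro u hu
    obtain ⟨v', hv', rfl⟩ := List.mem_map.1 hu
    exact hT.slots_eq_none (hCs v' (by simp [hv'])) (hB v' hv')
  · intro u hu
    obtain ⟨v', hv', rfl⟩ := List.mem_map.1 hu
    exact hT.slots_eq_none (hCs v' (by simp [hv'])) (hA v' hv')

theorem toList_filter_eq (D : Finset (Pair d nk nr)) (x y : Key d nk) :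
    (D.toList.filter fun p => InRange x y p.1).Perm (answers D x y).toList := by
  refine (List.perm_ext_iff_of_nodup (D.nodup_toList.filter _)
    (answers D x y).nodup_toList).2 fun p => ?_
  simp [answers]

/-- Each answer is flagged with probability `1 / S`. -/
theorem successProb_walkState
    {D : Finset (Pair d nk nr)} {T : RangeTree d nk nr w d}
    (hT : IsQuantumRangeTree b D T) (x y : Key d nk) {Cs : List (SNode d nk nr w)}
    (hCs : ∀ v ∈ Cs, v ∈ T.nodes d)
    (hperm : ((Cs.flatMap SNode.pairs).filter fun p => InRange x y p.1).Perm
      (D.toList.filter fun p => InRange x y p.1)) :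
    successProb (walkState (T.memory b) x y (candList Cs)) =
      (answers D x y).card / (Cs.map fun v => ((2 : ℝ) ^ b) ^ (v.height + 1)).sum := by
  have hp : ((hits b x y Cs).map fun s => s.2.1).Perm (answers D x y).toList := by
    rw [map_hits]
    exact hperm.trans (toList_filter_eq D x y)
  have hnd : ((hits b x y Cs).map
      (hitConfig (T.memory b) (topHeight (candList Cs)))).Nodup := by
    have h1 := (hp.nodup_iff).2 (answers D x y).nodup_toList
    refine List.Nodup.map_on ?_ h1.of_map
    intro s hs s' hs' h
    exact List.inj_on_of_nodup_map h1 hs hs'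
      (DataWord.ofPair_injective (congrArg Config.data h))
  have hcard : (hits b x y Cs).length = (answers D x y).card := by
    simpa using hp.length_eq
  rw [successProb, flagged_walkState hT.zeroDummy x y fun v hv => hT.represents (hCs v hv)]
  have := sum_norm_sq_smul_sum_single hnd
    ((1 / √((Cs.map fun v => ((2 : ℝ) ^ b) ^ (v.height + 1)).sum) : ℝ) : ℂ)
  rw [List.map_map] at this
  refine this.trans ?_
  have hS : 0 ≤ (Cs.map fun v => ((2 : ℝ) ^ b) ^ (v.height + 1)).sum :=
    List.sum_nonneg fun a ha => by
      obtain ⟨v, -, rfl⟩ := List.mem_map.1 ha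
      positivity
  rw [List.length_map, hcard, Complex.norm_real, Real.norm_eq_abs, sq_abs, div_pow,
    Real.sq_sqrt hS]
  ring

/-- The state returned is the uniform superposition of the answers, with all address registers
reset. -/
theorem run_reset_postSelect
    {D : Finset (Pair d nk nr)} {T : RangeTree d nk nr w d}
    (hT : IsQuantumRangeTree b D T) (x y : Key d nk) {Cs : List (SNode d nk nr w)}
    (hCs : ∀ v ∈ Cs, v ∈ T.nodes d)
    (hperm : ((Cs.flatMap SNode.pairs).filter fun p => InRange x y p.1).Perm
      (D.toList.filter fun p => InRange x y p.1))
    (hne : (answers D x y).Nonempty) :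
    runCircuit (T.memory b) x y (resetCircuit (topHeight (candList Cs)) (candList Cs))
      (postSelect (walkState (T.memory b) x y (candList Cs))) =
    (queryState D x y).mapDomain (output w b) := by
  have hp : ((hits b x y Cs).map fun s => s.2.1).Perm (answers D x y).toList := by
    rw [map_hits]
    exact hperm.trans (toList_filter_eq D x y)
  have hnd : ((Cs.flatMap SNode.pairs).filter fun p => InRange x y p.1).Nodup :=
    hperm.nodup_iff.2 (D.nodup_toList.filter _)
  have hk : (0 : ℝ) < (answers D x y).card := by exact_mod_cast hne.card_pos
  have hS : 0 < (Cs.map fun v => ((2 : ℝ) ^ b) ^ (v.height + 1)).sum := by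
    refine List.sum_pos _ (fun a ha => ?_) ?_
    · obtain ⟨v, -, rfl⟩ := List.mem_map.1 ha
      positivity
    · rw [Ne, List.map_eq_nil_iff]
      rintro rfl
      have := hp.length_eq
      simp only [hits, List.flatMap_nil, List.map_nil, List.length_nil,
        Finset.length_toList] at this
      exact hne.card_pos.ne this
  rw [runCircuit_eq, postSelect, successProb_walkState hT x y hCs hperm,
    flagged_walkState hT.zeroDummy x y fun v hv => hT.represents (hCs v hv), smul_smul,
    map_smul, map_list_sum, List.map_map]
  have hsum : ((hits b x y Cs).map (circuitMap (T.memory b) x y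
      (resetCircuit (topHeight (candList Cs)) (candList Cs)) ∘ fun s =>
        Finsupp.single (hitConfig (T.memory b) (topHeight (candList Cs)) s) 1)).sum =
      ∑ p ∈ answers D x y, Finsupp.single (output w b p) 1 := by
    refine (congrArg List.sum (List.map_congr_left (g := fun s =>
      Finsupp.single (output w b s.2.1) 1) fun s hs =>
        circuitMap_reset hT x y hCs hnd _ hs)).trans ?_
    rw [← Finset.sum_map_toList, ← (hp.map _).sum_eq, List.map_map]
    rfl
  rw [hsum, queryState, Finsupp.mapDomain_smul, Finsupp.mapDomain_finsetSum]
  simp only [Finsupp.mapDomain_single]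
  congr 1
  rw [← Complex.ofReal_mul, Real.sqrt_div hk.le]
  congr 1
  have : √(Cs.map fun v => ((2 : ℝ) ^ b) ^ (v.height + 1)).sum ≠ 0 := by positivity
  have : √((answers D x y).card : ℝ) ≠ 0 := by positivity
  field_simp

end Answer

/-! ### Correctness of the classical search -/

section Correct

variable {d nk nr w b : ℕ} {x y : Key d nk}

theorem InRange.coord {k : Key d nk} (h : InRange x y k) (i : ℕ) :
    coord x i ≤ coord k i ∧ coord k i ≤ coord y i := by
  unfold QuantumRange.coord
  split_ifs with hi
  · exact h _
  · exact ⟨BitVec.le_refl _, BitVec.le_refl _⟩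

/-- The key `k` lies in the box as far as the coordinates from the `n`-th on are concerned. -/
def InRangeFrom (n : ℕ) (x y k : Key d nk) : Prop :=
  ∀ j : Fin d, n ≤ (j : ℕ) → x j ≤ k j ∧ k j ≤ y j

theorem InRangeFrom.of_succ {n : ℕ} {k : Key d nk} (h : InRangeFrom (n + 1) x y k)
    (hn : coord x n ≤ coord k n ∧ coord k n ≤ coord y n) : InRangeFrom n x y k := by
  intro j hj
  rcases hj.eq_or_lt with rfl | hj
  · simpa [coord] using hn
  · exact h j hj

theorem Node.WellFormed.routed {A : Type} {i : ℕ} {ok : A → List (Pair d nk nr) → Prop} {h : ℕ}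
    {v : Node d nk nr w A h} (hv : v.WellFormed b i ok) : v.Routed i := by
  cases h with
  | zero => exact hv.2.2
  | succ h => exact hv.2.2.2.1

theorem Node.Routed.not_inRange_of_outside {A : Type} {i h : ℕ} {v : Node d nk nr w A h}
    (hv : v.Routed i) (ho : v.Outside x y i) {p : Pair d nk nr} (hp : p ∈ v.pairs) :
    ¬ InRange x y p.1 := by
  intro hr
  have h1 := hr.coord i
  have h2 := hv p hp
  simp only [Node.Outside, BitVec.le_def, BitVec.lt_def] at *
  omega

theorem Node.Routed.coord_of_inside {A : Type} {i h : ℕ} {v : Node d nk nr w A h}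
    (hv : v.Routed i) (hi : v.Inside x y i) {p : Pair d nk nr} (hp : p ∈ v.pairs) :
    coord x i ≤ coord p.1 i ∧ coord p.1 i ≤ coord y i :=
  ⟨BitVec.le_trans hi.1 (hv p hp).1, BitVec.le_trans (hv p hp).2 hi.2⟩

/-- The outcome of a search for the answers among the pairs `l` is correct if its candidates are
known nodes that together have each answer below them exactly once, and nothing else that is an
answer, and if the answers make up at least the fraction `1 / (8 * B)` of the
`∑ B ^ (h + 1)` places below the candidates. -/
def Found.Correct (b : ℕ) (x y : Key d nk) (nodes : List (SNode d nk nr w))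
    (l : List (Pair d nk nr)) (F : Found w) : Prop :=
  ∃ Cs : List (SNode d nk nr w), F.cands = candList Cs ∧ (∀ v ∈ Cs, v ∈ nodes) ∧
    ((Cs.flatMap SNode.pairs).filter fun p => InRange x y p.1).Perm
      (l.filter fun p => InRange x y p.1) ∧
    (Cs.map fun v => (2 ^ b) ^ (v.height + 1)).sum ≤
      8 * 2 ^ b * (l.filter fun p => InRange x y p.1).length

variable {nodes : List (SNode d nk nr w)} {l : List (Pair d nk nr)} {F : Found w}

theorem Found.Correct.mono (h : F.Correct b x y nodes l) {nodes' : List (SNode d nk nr w)}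
    (hn : ∀ v ∈ nodes, v ∈ nodes') : F.Correct b x y nodes' l := by
  obtain ⟨Cs, h1, h2, h3⟩ := h
  exact ⟨Cs, h1, fun v hv => hn v (h2 v hv), h3⟩

theorem Found.Correct.of_perm (h : F.Correct b x y nodes l) {l' : List (Pair d nk nr)}
    (hl : (l.filter fun p => InRange x y p.1).Perm (l'.filter fun p => InRange x y p.1)) :
    F.Correct b x y nodes l' := by
  obtain ⟨Cs, h1, h2, h3, h4⟩ := h
  exact ⟨Cs, h1, h2, h3.trans hl, hl.length_eq ▸ h4⟩

theorem Found.Correct.addSteps (h : F.Correct b x y nodes l) (s : ℕ) :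
    (F.addSteps s).Correct b x y nodes l := h

theorem Found.correct_of_forall_not (hF : F.cands = [])
    (hl : ∀ p ∈ l, ¬ InRange x y p.1) : F.Correct b x y nodes l := by
  have : (l.filter fun p => InRange x y p.1) = [] := by simpa [List.filter_eq_nil_iff] using hl
  exact ⟨[], hF, by simp, by simp [this], by simp⟩

theorem Found.correct_concat {I : Type} {L : List I} {G : I → Found w}
    {l : I → List (Pair d nk nr)} (h : ∀ i ∈ L, (G i).Correct b x y nodes (l i)) :
    (Found.concat (L.map G)).Correct b x y nodes (L.flatMap l) := by
  induction L with
  | nil => exact Found.correct_of_forall_not rfl (by simp)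
  | cons i L ih =>
    obtain ⟨Cs, h1, h2, h3, h4⟩ := h i List.mem_cons_self
    obtain ⟨Cs', h1', h2', h3', h4'⟩ := ih fun i hi => h i (List.mem_cons_of_mem _ hi)
    refine ⟨Cs ++ Cs', ?_, ?_, ?_, ?_⟩
    · rw [candList, List.map_append, ← candList, ← candList, ← h1, ← h1']
      rfl
    · intro v hv
      rcases List.mem_append.1 hv with hv | hv
      · exact h2 v hv
      · exact h2' v hv
    · rw [List.flatMap_append, List.filter_append, List.flatMap_cons, List.filter_append]
      exact h3.append h3'
    · rw [List.map_append, List.sum_append, List.flatMap_cons, List.filter_append,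
        List.length_append, mul_add]
      exact add_le_add h4 h4'

theorem correct_scanLeaf {n : ℕ} {v : Leaf d nk nr w}
    (hv : (⟨n, 0, v⟩ : SNode d nk nr w) ∈ nodes) :
    (scanLeaf x y v).Correct b x y nodes v.pairs := by
  by_cases h : ∃ p ∈ v.pairs, InRange x y p.1
  · refine ⟨[⟨n, 0, v⟩], ?_, by simpa using hv, ?_, ?_⟩
    · simp only [scanLeaf, if_pos h]
      rfl
    · simp only [List.flatMap_singleton]
      exact List.Perm.refl _
    · obtain ⟨p, hp, hr⟩ := h
      have : 0 < (v.pairs.filter fun p => InRange x y p.1).length :=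
        List.length_pos_of_mem (List.mem_filter.2 ⟨hp, decide_eq_true hr⟩)
      simp only [List.map_cons, List.map_nil, List.sum_cons, List.sum_nil, SNode.height,
        zero_add, pow_one, add_zero]
      nlinarith [Nat.two_pow_pos b]
  · refine Found.correct_of_forall_not ?_ fun p hp hr => h ⟨p, hp, hr⟩
    simp only [scanLeaf, if_neg h]

/-- The range of the node and the query range overlap, but the former is not inside the latter. -/
def Node.Partial {A : Type} (x y : Key d nk) (i : ℕ) {h : ℕ} (v : Node d nk nr w A h) : Prop :=
  ¬ v.Outside x y i ∧ ¬ v.Inside x y i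

/-- Of nodes whose ranges follow each other, only two can be partial: one for each end point of
the query range. -/
theorem Node.length_le_two_of_partial {A : Type} {i h : ℕ} {L : List (Node d nk nr w A h)}
    (hL : L.Pairwise fun c c' => c.hi ≤ c'.lo) (hp : ∀ v ∈ L, v.Partial x y i) :
    L.length ≤ 2 := by
  match L, hL, hp with
  | [], _, _ => simp
  | [_], _, _ => simp
  | [_, _], _, _ => simp
  | a :: e :: c :: _, hL, hp =>
    exfalso
    have ha := hp a (by simp)
    have he := hp e (by simp)
    have hc := hp c (by simp)
    simp only [List.pairwise_cons, List.mem_cons, forall_eq_or_imp] at hL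
    have h1 := hL.1.1
    have h2 := hL.1.2.1
    have h3 := hL.2.1.1
    clear hL hp
    simp only [Node.Partial, Node.Outside, Node.Inside, BitVec.le_def, BitVec.lt_def] at *
    omega

theorem Node.pairwise_flatMap_children {A : Type} {i h : ℕ}
    {ok : A → List (Pair d nk nr) → Prop} {L : List (Node d nk nr w A (h + 1))}
    (hL : L.Pairwise fun c c' => c.hi ≤ c'.lo) (hwf : ∀ v ∈ L, v.WellFormed b i ok) :
    (L.flatMap Node.children).Pairwise fun c c' => c.hi ≤ c'.lo := by
  rw [List.pairwise_flatMap]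
  refine ⟨fun v hv => (hwf v hv).2.2.1, hL.imp_of_mem fun {v v'} hv hv' hlt c hc c' hc' => ?_⟩
  exact BitVec.le_trans ((hwf v hv).2.1 c hc).2.2.2
    (BitVec.le_trans hlt ((hwf v' hv').2.1 c' hc').2.2.1)

theorem filter_flatMap_filter {A : Type} {i h : ℕ} {K : List (Node d nk nr w A h)}
    (hK : ∀ c ∈ K, c.Routed i) :
    ((K.filter fun c => ¬ c.Outside x y i).flatMap Node.pairs).filter
        (fun p => InRange x y p.1) =
      (K.flatMap Node.pairs).filter fun p => InRange x y p.1 := by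
  induction K with
  | nil => rfl
  | cons c K ih =>
    have ih := ih fun c hc => hK c (List.mem_cons_of_mem _ hc)
    by_cases ho : c.Outside x y i
    · have : (c.pairs.filter fun p => InRange x y p.1) = [] := by
        simpa [List.filter_eq_nil_iff] using
          fun a b h => (hK c List.mem_cons_self).not_inRange_of_outside ho (p := (a, b)) h
      rw [List.filter_cons_of_neg (by simpa using ho), ih, List.flatMap_cons,
        List.filter_append, this, List.nil_append]
    · rw [List.filter_cons_of_pos (by simpa using ho), List.flatMap_cons, List.flatMap_cons,
        List.filter_append, List.filter_append, ih]

/-- The list stays of length at most two because, as long as no child is inside, the children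
kept are partial. When a child is inside, all pairs below it are answers, which by balance are
at least the fraction `1 / (4 * B)` of the places below each of the at most two candidates. -/
theorem correct_globalSearch {n : ℕ} {T : RangeTree d nk nr w n} {m : ℕ} {h : ℕ}
    {ok : RangeTree d nk nr w m → List (Pair d nk nr) → Prop}
    {L : List (Node d nk nr w (RangeTree d nk nr w m) h)}
    (hmem : ∀ v ∈ L, (⟨m, h, v⟩ : SNode d nk nr w) ∈ T.nodes n)
    (hwf : ∀ v ∈ L, v.WellFormed b 0 ok) (hlen : L.length ≤ 2)
    (hsort : L.Pairwise fun c c' => c.hi ≤ c'.lo)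
    (hr : ∀ v ∈ L, ∀ p ∈ v.pairs, InRangeFrom 1 x y p.1) :
    (globalSearch x y 0 h L).Correct b x y (T.nodes n) (L.flatMap Node.pairs) := by
  induction h with
  | zero => exact Found.correct_concat fun v hv => correct_scanLeaf (hmem v hv)
  | succ h ih =>
    have hpairs : L.flatMap Node.pairs = (L.flatMap Node.children).flatMap Node.pairs := by
      rw [List.flatMap_assoc]
      rfl
    have hkid : ∀ c ∈ L.flatMap Node.children, ∃ v ∈ L, c ∈ v.children := fun c hc =>
      List.mem_flatMap.1 hc
    have hkidwf : ∀ c ∈ L.flatMap Node.children, c.WellFormed b 0 ok := fun c hc => by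
      obtain ⟨v, hv, hcv⟩ := hkid c hc
      exact ((hwf v hv).2.1 c hcv).1
    have hkidr : ∀ c ∈ L.flatMap Node.children, ∀ p ∈ c.pairs, InRangeFrom 1 x y p.1 := by
      intro c hc p hp
      obtain ⟨v, hv, hcv⟩ := hkid c hc
      exact hr v hv p (List.mem_flatMap.2 ⟨c, hcv, hp⟩)
    rw [globalSearch]
    by_cases hin : ∃ c ∈ L.flatMap Node.children, c.Inside x y 0
    · rw [if_pos hin]
      refine ⟨L.map fun v => ⟨m, h + 1, v⟩, ?_, ?_, ?_, ?_⟩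
      · rw [candList, List.map_map]
        rfl
      · intro s hs
        obtain ⟨v, hv, rfl⟩ := List.mem_map.1 hs
        exact hmem v hv
      · rw [List.flatMap_map]
        exact List.Perm.refl _
      · obtain ⟨c, hc, hci⟩ := hin
        have hall : (c.pairs.filter fun p => InRange x y p.1) = c.pairs := by
          refine List.filter_eq_self.2 fun p hp => decide_eq_true fun j => ?_
          exact ((hkidr c hc p hp).of_succ
            ((hkidwf c hc).routed.coord_of_inside hci hp)) j (Nat.zero_le _)
        have hcount : c.weight ≤
            ((L.flatMap Node.pairs).filter fun p => InRange x y p.1).length := by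
          rw [Node.weight, ← hall, hpairs]
          refine List.Sublist.length_le (List.Sublist.filter _ ?_)
          rw [List.flatMap_def]
          exact List.sublist_flatten_of_mem (List.mem_map_of_mem hc)
        obtain ⟨v, hv, hcv⟩ := hkid c hc
        have hbal := ((hwf v hv).2.1 c hcv).2.1.1
        rw [List.map_map]
        have : (L.map ((fun v : SNode d nk nr w => (2 ^ b) ^ (v.height + 1)) ∘
            fun v => ⟨m, h + 1, v⟩)).sum = L.length * (2 ^ b) ^ (h + 2) := by
          simp [Function.comp_def, SNode.height]
        rw [this, pow_succ _ (h + 1)]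
        calc L.length * ((2 ^ b) ^ (h + 1) * 2 ^ b)
            ≤ 2 * ((4 * c.weight) * 2 ^ b) := by gcongr
          _ = 8 * 2 ^ b * c.weight := by ring
          _ ≤ _ := by gcongr
    · rw [if_neg hin]
      have hsort' := Node.pairwise_flatMap_children hsort hwf
      have key := ih (L := (L.flatMap Node.children).filter fun c => ¬ c.Outside x y 0)
        (fun c hc => by
          obtain ⟨v, hv, hcv⟩ := hkid c (List.mem_of_mem_filter hc)
          exact RangeTree.child_mem_nodes (hmem v hv) hcv)
        (fun c hc => hkidwf c (List.mem_of_mem_filter hc))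
        (Node.length_le_two_of_partial (x := x) (y := y) (i := 0) (hsort'.filter _)
          fun c hc => ⟨by simpa using (List.mem_filter.1 hc).2,
            fun h' => hin ⟨c, List.mem_of_mem_filter hc, h'⟩⟩)
        (hsort'.filter _)
        (fun c hc => hkidr c (List.mem_of_mem_filter hc))
      refine (key.addSteps _).of_perm (List.Perm.of_eq ?_)
      rw [hpairs, filter_flatMap_filter fun c hc => (hkidwf c hc).routed]

/-- Below an inside node every pair has its `i`-th coordinate in the query range, so that the
attached tree has to deal with the coordinates below `i` only. -/
theorem correct_coverSearch {m i : ℕ} {inner : RangeTree d nk nr w m → Found w}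
    (hinner : ∀ (a : RangeTree d nk nr w m) (l : List (Pair d nk nr)), a.IsFor b m l →
      (∀ p ∈ l, InRangeFrom i x y p.1) → (inner a).Correct b x y (a.nodes m) l)
    {h : ℕ} {v : Node d nk nr w (RangeTree d nk nr w m) h}
    (hwf : v.WellFormed b i (RangeTree.IsFor b m))
    (hr : ∀ p ∈ v.pairs, InRangeFrom (i + 1) x y p.1) :
    (coverSearch x y i inner v).Correct b x y
      (v.collect (fun h v => [⟨m, h, v⟩]) (RangeTree.nodes m)) v.pairs := by
  induction h with
  | zero =>
    rw [coverSearch]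
    split_ifs with ho
    · exact Found.correct_of_forall_not rfl fun p hp =>
        hwf.routed.not_inRange_of_outside ho hp
    · exact (correct_scanLeaf (Node.self_mem_collect v _)).addSteps 1
  | succ h ih =>
    rw [coverSearch]
    split_ifs with ho hi
    · exact Found.correct_of_forall_not rfl fun p hp =>
        hwf.routed.not_inRange_of_outside ho hp
    · refine ((hinner v.aux v.pairs hwf.2.2.2.2 fun p hp => (hr p hp).of_succ
        (hwf.routed.coord_of_inside hi hp)).addSteps 1).mono fun s hs => ?_
      simp [Node.collect, hs]
    · refine (Found.correct_concat fun c hc =>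
        (ih (hwf.2.1 c hc).1 fun p hp => hr p (List.mem_flatMap.2 ⟨c, hc, hp⟩)).mono
          fun s hs => ?_).addSteps 1
      rw [Node.collect]
      exact List.mem_append_right _ (List.mem_flatMap.2 ⟨c, hc, hs⟩)

theorem RangeTree.correct_search {n : ℕ} {T : RangeTree d nk nr w (n + 1)}
    {l : List (Pair d nk nr)} (hT : T.IsFor b (n + 1) l)
    (hl : ∀ p ∈ l, InRangeFrom (n + 1) x y p.1) :
    (T.search x y (n + 1)).Correct b x y (T.nodes (n + 1)) l := by
  induction n generalizing l with
  | zero =>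
    have hp := hT.1
    have := correct_globalSearch (x := x) (y := y) (L := [BPlusTree.root T]) (T := T) (n := 1)
      (ok := RangeTree.IsFor b 0)
      (fun v hv => List.mem_singleton.1 hv ▸
        Node.self_mem_collect (BPlusTree.root T) (RangeTree.nodes 0))
      (by simpa using hT.2.2) (by simp) (by simp)
      (by simpa using fun a b h => hl (a, b) (hp.mem_iff.1 h))
    rw [List.flatMap_singleton] at this
    exact Found.Correct.of_perm (F := RangeTree.search x y 1 T) this (hp.filter _)
  | succ n ih =>
    have hp := hT.1
    exact (correct_coverSearch (fun a l ha hl => ih ha hl) hT.2.2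
      fun p h => hl p (hp.mem_iff.1 h)).of_perm (hp.filter _)

end Correct

/-! ### The cost of the classical search -/

section Cost

variable {d nk nr w b : ℕ} {x y : Key d nk}

theorem Node.length_children_le {A : Type} {h : ℕ} {v : Node d nk nr w A (h + 1)}
    {c : Node d nk nr w A h} (hc : c ∈ v.children) : c.pairs.length ≤ v.pairs.length := by
  refine List.Sublist.length_le ?_
  rw [Node.pairs, List.flatMap_def]
  exact List.sublist_flatten_of_mem (List.mem_map_of_mem hc)

/-- A root of height `h ≥ 1` has at least two children with at least `B ^ h / 4` pairs each. -/
theorem Node.pow_height_le {A : Type} {i h : ℕ} {ok : A → List (Pair d nk nr) → Prop}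
    {v : Node d nk nr w A (h + 1)} (hwf : v.WellFormed b i ok) (hdeg : v.RootDegree) :
    (2 ^ b) ^ (h + 1) ≤ 2 * v.pairs.length := by
  have h2 : 2 ≤ v.children.length := hdeg
  have hsum : v.children.length * (2 ^ b) ^ (h + 1) ≤ 4 * v.pairs.length := by
    rw [Node.pairs, List.length_flatMap]
    have hbal : ∀ c ∈ v.children, (2 ^ b) ^ (h + 1) ≤ 4 * c.pairs.length :=
      fun c hc => (hwf.2.1 c hc).2.1.1
    generalize v.children = K at hbal
    induction K with
    | nil => simp
    | cons c K ih =>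
      have := ih fun c hc => hbal c (List.mem_cons_of_mem _ hc)
      have := hbal c List.mem_cons_self
      simp only [List.length_cons, List.map_cons, List.sum_cons]
      linarith
  have := (Nat.mul_le_mul_right ((2 ^ b) ^ (h + 1)) h2).trans hsum
  omega

/-- A bound for the heights of range trees of at most `N` pairs. -/
def heightBound (b N : ℕ) : ℕ := Nat.log (2 ^ b) (2 * N)

theorem Node.height_le_heightBound {A : Type} {i h N : ℕ} {ok : A → List (Pair d nk nr) → Prop}
    {v : Node d nk nr w A h} (hb : b ≠ 0) (hwf : v.WellFormed b i ok) (hdeg : v.RootDegree)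
    (hN : v.pairs.length ≤ N) : h ≤ heightBound b N := by
  cases h with
  | zero => exact Nat.zero_le _
  | succ h =>
    exact Nat.le_log_of_pow_le (Nat.one_lt_two_pow hb)
      ((Node.pow_height_le hwf hdeg).trans (Nat.mul_le_mul_left 2 hN))

theorem RangeTree.IsFor.height_le {n : ℕ} {T : RangeTree d nk nr w n} (hb : b ≠ 0)
    {l : List (Pair d nk nr)} (hT : T.IsFor b n l) {N : ℕ} (hN : l.length ≤ N)
    {s : SNode d nk nr w} (hs : s ∈ T.nodes n) : s.height ≤ heightBound b N := by
  induction n generalizing l with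
  | zero => simp [RangeTree.nodes] at hs
  | succ n ih =>
    obtain ⟨hp, hdeg, hwf⟩ := hT
    rw [← hp.length_eq] at hN
    have hroot := Node.height_le_heightBound hb hwf hdeg hN
    simp only [RangeTree.nodes] at hs
    clear hdeg hp
    generalize BPlusTree.root T = r at hs hwf hN
    generalize BPlusTree.height T = k at r hs hwf hN hroot
    induction k with
    | zero =>
      simp only [Node.collect, List.mem_singleton] at hs
      subst hs
      exact hroot
    | succ k ihk =>
      simp only [Node.collect, List.mem_append, List.mem_flatMap, List.mem_singleton] at hs
      rcases hs with (hs | hs) | ⟨c, hc, hs⟩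
      · subst hs
        exact hroot
      · exact ih hwf.2.2.2.2 hN hs
      · exact ihk c hs (hwf.2.1 c hc).1 ((Node.length_children_le hc).trans hN) (by omega)

/-- The steps of a search, and its candidates and one-dimensional trees with the weight `m`.
With `m` of the order of `log N` the three bounds of the analysis become one. -/
def Found.cost (m : ℕ) (F : Found w) : ℕ := F.steps + m * (F.cands.length + F.oneDim)

theorem Found.cost_concat {I : Type} (m : ℕ) (L : List I) (G : I → Found w) :
    (Found.concat (L.map G)).cost m = (L.map fun i => (G i).cost m).sum := by
  induction L with
  | nil => rfl
  | cons i L ih =>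
    rw [List.map_cons, List.map_cons, List.sum_cons, ← ih]
    simp only [Found.cost, Found.concat, List.flatMap_cons, List.map_cons, List.sum_cons,
      List.length_append]
    ring

theorem Found.cost_addSteps (m s : ℕ) (F : Found w) : (F.addSteps s).cost m = F.cost m + s := by
  simp only [Found.cost, Found.addSteps]
  ring

theorem length_cands_scanLeaf_le (v : Leaf d nk nr w) : (scanLeaf x y v).cands.length ≤ 1 := by
  simp only [scanLeaf]
  split_ifs <;> simp

theorem cost_scanLeaf_le (m : ℕ) {v : Leaf d nk nr w} (hv : v.pairs.length ≤ 2 ^ b) :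
    (scanLeaf x y v).cost m ≤ d + d * 2 ^ b + m := by
  have h1 := length_cands_scanLeaf_le (x := x) (y := y) v
  calc (scanLeaf x y v).cost m
      = d + d * v.pairs.length + m * ((scanLeaf x y v).cands.length + 0) := rfl
    _ ≤ d + d * 2 ^ b + m * (1 + 0) := by gcongr
    _ = _ := by ring

theorem length_flatMap_children_le {A : Type} {i h : ℕ} {ok : A → List (Pair d nk nr) → Prop}
    {L : List (Node d nk nr w A (h + 1))} (hwf : ∀ v ∈ L, v.WellFormed b i ok) :
    (L.flatMap Node.children).length ≤ L.length * 2 ^ b := by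
  rw [List.length_flatMap]
  have := List.sum_le_card_nsmul (L.map fun v => v.children.length) (2 ^ b) fun a ha => by
    obtain ⟨v, hv, rfl⟩ := List.mem_map.1 ha
    exact (hwf v hv).1
  simpa using this

/-- The cost of handling one level of the global search. -/
def levelCost (d b : ℕ) : ℕ := 2 * (d + 2 ^ b + d * 2 ^ b)

theorem cost_globalSearch_le {A : Type} {m h : ℕ} {ok : A → List (Pair d nk nr) → Prop}
    {L : List (Node d nk nr w A h)} (hwf : ∀ v ∈ L, v.WellFormed b 0 ok)
    (hlen : L.length ≤ 2) (hsort : L.Pairwise fun c c' => c.hi ≤ c'.lo) :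
    (globalSearch x y 0 h L).cost m ≤ levelCost d b * (h + 1) + m * 2 := by
  induction h with
  | zero =>
    refine (Found.cost_concat m L (scanLeaf x y)).trans_le ?_
    have := List.sum_le_card_nsmul (L.map fun v => (scanLeaf x y v).cost m)
      (d + d * 2 ^ b + m) fun a ha => by
        obtain ⟨v, hv, rfl⟩ := List.mem_map.1 ha
        exact cost_scanLeaf_le m (hwf v hv).1
    refine this.trans ?_
    rw [smul_eq_mul, levelCost]
    have hlen' : (List.map (fun v : Leaf d nk nr w => (scanLeaf x y v).cost m) L).length ≤ 2 :=
      (List.length_map _).trans_le hlen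
    calc _ ≤ 2 * (d + d * 2 ^ b + m) := Nat.mul_le_mul_right _ hlen'
      _ ≤ _ := by nlinarith [Nat.zero_le (2 ^ b)]
  | succ h ih =>
    have hkids := length_flatMap_children_le hwf
    have hstep : d * L.length + (L.flatMap Node.children).length ≤ levelCost d b := by
      calc d * L.length + (L.flatMap Node.children).length
          ≤ d * L.length + L.length * 2 ^ b := by gcongr
        _ ≤ d * 2 + 2 * 2 ^ b := by gcongr
        _ ≤ levelCost d b := by rw [levelCost]; nlinarith [Nat.zero_le (d * 2 ^ b)]
    have hkidwf : ∀ c ∈ L.flatMap Node.children, c.WellFormed b 0 ok := fun c hc => by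
      obtain ⟨v, hv, hcv⟩ := List.mem_flatMap.1 hc
      exact ((hwf v hv).2.1 c hcv).1
    rw [globalSearch]
    by_cases hin : ∃ c ∈ L.flatMap Node.children, c.Inside x y 0
    · rw [if_pos hin]
      simp only [Found.cost, List.length_map, add_zero]
      have : levelCost d b ≤ levelCost d b * (h + 1 + 1) := Nat.le_mul_of_pos_right _ (by omega)
      exact add_le_add (hstep.trans this) (Nat.mul_le_mul_left m hlen)
    · rw [if_neg hin]
      have hsort' := (Node.pairwise_flatMap_children hsort hwf).filter
        fun c => ¬ c.Outside x y 0
      have key := ih (L := (L.flatMap Node.children).filter fun c => ¬ c.Outside x y 0)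
        (fun c hc => hkidwf c (List.mem_of_mem_filter hc))
        (Node.length_le_two_of_partial (x := x) (y := y) (i := 0) hsort'
          fun c hc => ⟨by simpa using (List.mem_filter.1 hc).2,
            fun h' => hin ⟨c, List.mem_of_mem_filter hc, h'⟩⟩) hsort'
      refine (Found.cost_addSteps m _ _).trans_le ((add_le_add key hstep).trans (le_of_eq ?_))
      ring

instance {A : Type} (x y : Key d nk) (i : ℕ) {h : ℕ} (v : Node d nk nr w A h) :
    Decidable (v.Partial x y i) :=
  inferInstanceAs (Decidable (_ ∧ _))

/-- The nodes visited are the top ones and the children of partial nodes; as only two nodes of a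
level are partial, the latter are at most `2 * B` for each level. -/
theorem cost_coverSearch_le {A : Type} {m i I N h : ℕ} {ok : A → List (Pair d nk nr) → Prop}
    {inner : A → Found w} (hinner : ∀ a l, ok a l → l.length ≤ N → (inner a).cost m ≤ I)
    {L : List (Node d nk nr w A h)} (hwf : ∀ v ∈ L, v.WellFormed b i ok)
    (hN : ∀ v ∈ L, v.pairs.length ≤ N) (hsort : L.Pairwise fun c c' => c.hi ≤ c'.lo) :
    (L.map fun v => (coverSearch x y i inner v).cost m).sum ≤
      (L.length + 2 * 2 ^ b * h) * (1 + (d + d * 2 ^ b + m) + I) := by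
  induction h with
  | zero =>
    have := List.sum_le_card_nsmul (L.map fun v => (coverSearch x y i inner v).cost m)
      (1 + (d + d * 2 ^ b + m) + I) fun a ha => by
        obtain ⟨v, hv, rfl⟩ := List.mem_map.1 ha
        rw [coverSearch]
        split_ifs with ho
        · simp [Found.cost]
          omega
        · have := cost_scanLeaf_le (x := x) (y := y) m (hwf v hv).1
          exact (Found.cost_addSteps m 1 (scanLeaf x y v)).trans_le (by omega)
    simpa using this
  | succ h ih =>
    set κ := 1 + (d + d * 2 ^ b + m) + I with hκ
    have hone : (L.map fun v => (coverSearch x y i inner v).cost m).sum ≤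
        L.length * κ + (((L.filter fun v => v.Partial x y i).flatMap Node.children).map
          fun c => (coverSearch x y i inner c).cost m).sum := by
      clear hsort
      induction L with
      | nil => simp
      | cons v L ihL =>
        have ihL := ihL (fun v hv => hwf v (List.mem_cons_of_mem _ hv))
          fun v hv => hN v (List.mem_cons_of_mem _ hv)
        rw [List.map_cons, List.sum_cons, List.length_cons]
        by_cases hpart : v.Partial x y i
        · rw [List.filter_cons_of_pos (by simpa using hpart), List.flatMap_cons,
            List.map_append, List.sum_append]
          have hv : (coverSearch x y i inner v).cost m =
              (v.children.map fun c => (coverSearch x y i inner c).cost m).sum + 1 := by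
            rw [coverSearch, if_neg hpart.1, if_neg hpart.2, Found.cost_addSteps,
              Found.cost_concat]
          rw [hv]
          have : 1 ≤ κ := by omega
          linarith
        · rw [List.filter_cons_of_neg (by simpa using hpart)]
          have hv : (coverSearch x y i inner v).cost m ≤ κ := by
            rw [coverSearch]
            split_ifs with ho hi
            · simp [Found.cost]
              omega
            · have := hinner v.aux v.pairs (hwf v List.mem_cons_self).2.2.2.2
                (hN v List.mem_cons_self)
              rw [Found.cost_addSteps]
              omega
            · exact absurd ⟨ho, hi⟩ hpart
          linarith
    have hwf' : ∀ v ∈ L.filter fun v => v.Partial x y i, v.WellFormed b i ok :=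
      fun v hv => hwf v (List.mem_of_mem_filter hv)
    have hmem : ∀ c ∈ (L.filter fun v => v.Partial x y i).flatMap Node.children,
        ∃ v ∈ L, c ∈ v.children := fun c hc => by
      obtain ⟨v, hv, hcv⟩ := List.mem_flatMap.1 hc
      exact ⟨v, List.mem_of_mem_filter hv, hcv⟩
    have key := ih (L := (L.filter fun v => v.Partial x y i).flatMap Node.children)
      (fun c hc => by
        obtain ⟨v, hv, hcv⟩ := hmem c hc
        exact ((hwf v hv).2.1 c hcv).1)
      (fun c hc => by
        obtain ⟨v, hv, hcv⟩ := hmem c hc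
        exact (Node.length_children_le hcv).trans (hN v hv))
      (Node.pairwise_flatMap_children (hsort.filter _) hwf')
    have hlen := Node.length_le_two_of_partial (x := x) (y := y) (i := i)
      (hsort.filter fun v => v.Partial x y i)
      fun v hv => by simpa using (List.mem_filter.1 hv).2
    have hkids := (length_flatMap_children_le hwf').trans
      (Nat.mul_le_mul_right (2 ^ b) hlen)
    calc _ ≤ L.length * κ + (2 * 2 ^ b + 2 * 2 ^ b * h) * κ :=
          hone.trans (Nat.add_le_add_left (key.trans (by gcongr)) _)
      _ = _ := by ring

/-- The constant in the bound for the cost of the search in an `(n + 1)`-dimensional tree. -/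
def searchConst (d b : ℕ) : ℕ → ℕ
  | 0 => levelCost d b + 3
  | n + 1 => (1 + 2 * 2 ^ b) * (2 + d + d * 2 ^ b + searchConst d b n)

theorem RangeTree.cost_search_le (hb : b ≠ 0) {N n : ℕ} {T : RangeTree d nk nr w (n + 1)}
    {l : List (Pair d nk nr)} (hT : T.IsFor b (n + 1) l) (hN : l.length ≤ N) :
    (T.search x y (n + 1)).cost (heightBound b N + 1) ≤
      searchConst d b n * (heightBound b N + 1) ^ (n + 1) := by
  have hh : ∀ {n : ℕ} {T : RangeTree d nk nr w (n + 1)} {l : List (Pair d nk nr)},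
      T.IsFor b (n + 1) l → l.length ≤ N → BPlusTree.height T ≤ heightBound b N :=
    fun hT hN => Node.height_le_heightBound hb hT.2.2 hT.2.1 (hT.1.length_eq ▸ hN)
  set m := heightBound b N + 1 with hm
  induction n generalizing l with
  | zero =>
    have h1 := hh hT hN
    have key := cost_globalSearch_le (x := x) (y := y) (m := m) (L := [BPlusTree.root T])
      (by simpa using hT.2.2) (by simp) (by simp)
    have hcost : (T.search x y 1).cost m =
        (globalSearch x y 0 (BPlusTree.height T) [BPlusTree.root T]).steps +
        m * ((globalSearch x y 0 (BPlusTree.height T) [BPlusTree.root T]).cands.length + 1) :=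
      rfl
    rw [Found.cost] at key
    rw [hcost, searchConst, zero_add, pow_one]
    have h2 : levelCost d b * (BPlusTree.height T + 1) ≤ levelCost d b * m :=
      Nat.mul_le_mul_left _ (by omega)
    nlinarith
  | succ n ih =>
    have h1 := hh hT hN
    have key := cost_coverSearch_le (x := x) (y := y) (i := n + 1)
      (L := [BPlusTree.root T]) (N := N) (fun a l ha hl => ih ha hl)
      (by simpa using hT.2.2) (by simpa using hT.1.length_eq ▸ hN) (by simp)
    simp only [List.map_cons, List.map_nil, List.sum_cons, List.sum_nil, add_zero,
      List.length_singleton] at key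
    have hm1 : 1 ≤ m := by omega
    have hmn : m ≤ m ^ (n + 1) := by
      simpa using Nat.pow_le_pow_right hm1 (Nat.le_add_left 1 n)
    have hmn1 : 1 ≤ m ^ (n + 1) := hm1.trans hmn
    have hd : d ≤ d * m ^ (n + 1) := Nat.le_mul_of_pos_right _ hmn1
    have hdB : d * 2 ^ b ≤ d * 2 ^ b * m ^ (n + 1) := Nat.le_mul_of_pos_right _ hmn1
    have hB : 2 * 2 ^ b * BPlusTree.height T ≤ 2 * 2 ^ b * m := Nat.mul_le_mul_left _ (by omega)
    rw [searchConst, pow_succ m (n + 1),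
      mul_comm (m ^ (n + 1)) m, mul_mul_mul_comm]
    refine key.trans (Nat.mul_le_mul ?_ ?_)
    · rw [add_mul]
      omega
    · rw [add_mul, add_mul, add_mul]
      omega

end Cost

/-! ### Every data set has a quantum range tree -/

section Existence

variable {d nk nr : ℕ}

/-- The identifiers are distinct and, as numbers, lie in the interval `[a, a + K)`. -/
def FreshIds {w : ℕ} (ids : List (BitVec w)) (a K : ℕ) : Prop :=
  ids.Nodup ∧ ∀ u ∈ ids, a ≤ u.toNat ∧ u.toNat < a + K

theorem FreshIds.append {w : ℕ} {l l' : List (BitVec w)} {a K K' : ℕ} (h : FreshIds l a K)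
    (h' : FreshIds l' (a + K) K') : FreshIds (l ++ l') a (K + K') := by
  refine ⟨h.1.append h'.1 fun u hu hu' => ?_, fun u hu => ?_⟩
  · have := (h.2 u hu).2
    have := (h'.2 u hu').1
    omega
  · rcases List.mem_append.1 hu with hu | hu
    · have := h.2 u hu
      omega
    · have := h'.2 u hu
      omega

theorem freshIds_nil {w a : ℕ} : FreshIds ([] : List (BitVec w)) a 0 :=
  ⟨List.nodup_nil, by simp⟩

theorem freshIds_ofNat {w a : ℕ} (h : a + 1 ≤ 2 ^ w) : FreshIds [BitVec.ofNat w a] a 1 := by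
  refine ⟨List.nodup_singleton _, fun u hu => ?_⟩
  rw [List.mem_singleton.1 hu, BitVec.toNat_ofNat, Nat.mod_eq_of_lt (by omega)]
  omega

/-- The pairs are sorted by the `i`-th coordinate. -/
def SortedBy (i : ℕ) (l : List (Pair d nk nr)) : Prop :=
  l.Pairwise fun p q => coord p.1 i ≤ coord q.1 i

theorem exists_sortedBy_perm (i : ℕ) (l : List (Pair d nk nr)) :
    ∃ l' : List (Pair d nk nr), l'.Perm l ∧ SortedBy i l' := by
  refine ⟨l.mergeSort fun p q => decide (coord p.1 i ≤ coord q.1 i), List.mergeSort_perm _ _, ?_⟩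
  have := List.pairwise_mergeSort (le := fun p q : Pair d nk nr =>
    decide (coord p.1 i ≤ coord q.1 i))
    (fun a b c hab hbc => by
      simp only [decide_eq_true_eq] at *
      exact BitVec.le_trans hab hbc)
    (fun a b => by
      simp only [BitVec.le_def, Bool.or_eq_true, decide_eq_true_eq]
      omega) l
  exact this.imp fun h => by simpa using h

theorem SortedBy.exists_min {i : ℕ} {l : List (Pair d nk nr)} (h : SortedBy i l) (hl : l ≠ []) :
    ∃ p ∈ l, ∀ q ∈ l, coord p.1 i ≤ coord q.1 i := by
  obtain ⟨p, l, rfl⟩ := List.exists_cons_of_ne_nil hl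
  refine ⟨p, List.mem_cons_self, fun q hq => ?_⟩
  rcases List.mem_cons.1 hq with rfl | hq
  · exact BitVec.le_refl _
  · exact (List.pairwise_cons.1 h).1 q hq

theorem SortedBy.exists_max {i : ℕ} {l : List (Pair d nk nr)} (h : SortedBy i l) (hl : l ≠ []) :
    ∃ p ∈ l, ∀ q ∈ l, coord q.1 i ≤ coord p.1 i := by
  induction l with
  | nil => exact absurd rfl hl
  | cons a l ih =>
    rcases l.eq_nil_or_concat with rfl | ⟨_, _, rfl⟩
    · exact ⟨a, by simp, by simp⟩
    · obtain ⟨p, hp, hmax⟩ := ih (List.pairwise_cons.1 h).2 (by simp)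
      refine ⟨p, List.mem_cons_of_mem _ hp, fun q hq => ?_⟩
      rcases List.mem_cons.1 hq with rfl | hq
      · exact (List.pairwise_cons.1 h).1 p hp
      · exact hmax q hq

/-- A list can be cut into `c` consecutive pieces with lengths between `lo` and `hi` whenever
its length permits it. -/
theorem exists_pieces {α : Type} {lo hi : ℕ} (hlh : lo ≤ hi) (c : ℕ) (l : List α)
    (h1 : c * lo ≤ l.length) (h2 : l.length ≤ c * hi) :
    ∃ ls : List (List α), ls.flatten = l ∧ ls.length = c ∧
      ∀ k ∈ ls, lo ≤ k.length ∧ k.length ≤ hi := by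
  induction c generalizing l with
  | zero => exact ⟨[], by simpa using (by simpa using h2 : l = []).symm, rfl, by simp⟩
  | succ c ih =>
    have hlc : c * lo ≤ c * hi := Nat.mul_le_mul_left c hlh
    rw [Nat.succ_mul] at h1 h2
    -- The first piece is as short as the other pieces allow.
    obtain ⟨s, hs1, hs2, hs3, hs4⟩ : ∃ s, lo ≤ s ∧ s ≤ hi ∧ c * lo + s ≤ l.length ∧
        l.length ≤ c * hi + s :=
      ⟨max lo (l.length - c * hi), by omega, by omega, by omega, by omega⟩
    obtain ⟨ls, hls, hlen, hk⟩ := ih (l.drop s) (by rw [List.length_drop]; omega)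
      (by rw [List.length_drop]; omega)
    refine ⟨l.take s :: ls, by simp [hls], by simp [hlen], fun k hk' => ?_⟩
    rcases List.mem_cons.1 hk' with rfl | hk'
    · rw [List.length_take]
      omega
    · exact hk k hk'

/-- The identifiers of the nodes of a subtree, with those of all attached trees. -/
def Node.treeIds {n w h : ℕ} (v : Node d nk nr w (RangeTree d nk nr w n) h) :
    List (BitVec w) :=
  v.collect (fun _ v => [v.id]) RangeTree.ids

/-- The end points of the routing key of `v` are coordinates of pairs below `v`. -/
def Node.Tight {A : Type} {w : ℕ} (i : ℕ) {h : ℕ} (v : Node d nk nr w A h) : Prop :=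
  (∃ p ∈ v.pairs, v.lo = coord p.1 i) ∧ ∃ p ∈ v.pairs, v.hi = coord p.1 i

/-- For some number `K`, a range tree for the pairs `l` can be built with identifiers taken
from any `K` consecutive numbers. -/
def TreeExists (b n : ℕ) (l : List (Pair d nk nr)) : Prop :=
  ∃ K : ℕ, ∀ w a : ℕ, a + K ≤ 2 ^ w →
    ∃ T : RangeTree d nk nr w n, T.IsFor b n l ∧ FreshIds T.ids a K

/-- For some number `K`, a subtree of height `h` of an `(n + 1)`-dimensional range tree,
holding exactly the pairs `l` in this order, can be built with identifiers taken from any `K`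
consecutive numbers. -/
def NodeExists (b n h : ℕ) (l : List (Pair d nk nr)) : Prop :=
  ∃ K : ℕ, ∀ w a : ℕ, a + K ≤ 2 ^ w →
    ∃ v : Node d nk nr w (RangeTree d nk nr w n) h, v.pairs = l ∧ v.RootDegree ∧
      v.WellFormed b n (RangeTree.IsFor b n) ∧ v.Tight n ∧ FreshIds v.treeIds a K

variable {b n : ℕ}

theorem nodeExists_leaf {l : List (Pair d nk nr)} (hs : SortedBy n l) (hl : l ≠ [])
    (hlen : l.length ≤ 2 ^ b) : NodeExists b n 0 l := by
  obtain ⟨p, hp, hmin⟩ := hs.exists_min hl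
  obtain ⟨q, hq, hmax⟩ := hs.exists_max hl
  refine ⟨1, fun w a ha => ?_⟩
  exact ⟨(⟨BitVec.ofNat w a, coord p.1 n, coord q.1 n, l⟩ : Leaf d nk nr w), rfl, trivial,
    ⟨hlen, hs, fun r hr => ⟨hmin r hr, hmax r hr⟩⟩, ⟨⟨p, hp, rfl⟩, ⟨q, hq, rfl⟩⟩,
    freshIds_ofNat ha⟩

theorem exists_children {h : ℕ} {ls : List (List (Pair d nk nr))}
    (hls : ∀ l ∈ ls, NodeExists b n h l) :
    ∃ K : ℕ, ∀ w a : ℕ, a + K ≤ 2 ^ w →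
      ∃ cs : List (Node d nk nr w (RangeTree d nk nr w n) h), cs.map Node.pairs = ls ∧
        (∀ c ∈ cs, c.WellFormed b n (RangeTree.IsFor b n) ∧ c.Tight n) ∧
        FreshIds (cs.flatMap Node.treeIds) a K := by
  induction ls with
  | nil => exact ⟨0, fun w a _ => ⟨[], rfl, by simp, freshIds_nil⟩⟩
  | cons l ls ih =>
    obtain ⟨K, hK⟩ := hls l List.mem_cons_self
    obtain ⟨K', hK'⟩ := ih fun l hl => hls l (List.mem_cons_of_mem _ hl)
    refine ⟨K + K', fun w a ha => ?_⟩
    obtain ⟨c, hc1, -, hc2, hc3, hc4⟩ := hK w a (by omega)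
    obtain ⟨cs, hcs1, hcs2, hcs3⟩ := hK' w (a + K) (by omega)
    refine ⟨c :: cs, by rw [List.map_cons, hc1, hcs1], fun c' hc' => ?_, hc4.append hcs3⟩
    rcases List.mem_cons.1 hc' with rfl | hc'
    · exact ⟨hc2, hc3⟩
    · exact hcs2 c' hc'

theorem nodeExists_inner (haux : ∀ l : List (Pair d nk nr), TreeExists b n l) {h : ℕ}
    {ls : List (List (Pair d nk nr))} (hls : ∀ l ∈ ls, NodeExists b n h l)
    (hbal : ∀ l ∈ ls, (2 ^ b) ^ (h + 1) ≤ 4 * l.length ∧ l.length ≤ (2 ^ b) ^ (h + 1))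
    (h2 : 2 ≤ ls.length) (hB : ls.length ≤ 2 ^ b) (hs : SortedBy n ls.flatten) :
    NodeExists b n (h + 1) ls.flatten := by
  obtain ⟨K, hK⟩ := exists_children hls
  obtain ⟨K', hK'⟩ := haux ls.flatten
  have hne : ls.flatten ≠ [] := by
    obtain ⟨l, ls, rfl⟩ := List.exists_cons_of_ne_nil (l := ls) (by rintro rfl; simp at h2)
    have h1 := (hbal l List.mem_cons_self).1
    have : 0 < (2 ^ b) ^ (h + 1) := by positivity
    intro h0
    have : l = [] := by simp_all
    simp_all
  obtain ⟨p, hp, hmin⟩ := hs.exists_min hne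
  obtain ⟨q, hq, hmax⟩ := hs.exists_max hne
  refine ⟨1 + K' + K, fun w a ha => ?_⟩
  obtain ⟨T, hT, hTids⟩ := hK' w (a + 1) (by omega)
  obtain ⟨cs, hcs1, hcs2, hcs3⟩ := hK w (a + (1 + K')) (by omega)
  set v : Node d nk nr w (RangeTree d nk nr w n) (h + 1) :=
    (⟨BitVec.ofNat w a, coord p.1 n, coord q.1 n, T, cs⟩ : Inner nk w _ _) with hv
  have hpairs : v.pairs = ls.flatten := by
    rw [← hcs1, ← List.flatMap_def]
    rfl
  have hlen : cs.length = ls.length := by rw [← hcs1, List.length_map]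
  have hcmem : ∀ c ∈ cs, c.pairs ∈ ls := fun c hc => hcs1 ▸ List.mem_map_of_mem hc
  have hmem : ∀ c ∈ cs, ∀ r ∈ c.pairs, r ∈ ls.flatten := fun c hc r hr =>
    List.mem_flatten_of_mem (hcmem c hc) hr
  refine ⟨v, hpairs, h2.trans_eq hlen.symm, ⟨hlen.trans_le hB, fun c hc => ?_, ?_, ?_, ?_⟩,
    ⟨⟨p, hpairs ▸ hp, rfl⟩, ⟨q, hpairs ▸ hq, rfl⟩⟩, ?_⟩
  · obtain ⟨hwf, ⟨p', hp', hlo⟩, q', hq', hhi⟩ := hcs2 c hc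
    exact ⟨hwf, hbal _ (hcmem c hc), hlo ▸ hmin p' (hmem c hc p' hp'),
      hhi ▸ hmax q' (hmem c hc q' hq')⟩
  · have := (List.pairwise_flatten.1 hs).2
    rw [← hcs1, List.pairwise_map] at this
    refine this.imp_of_mem fun {c c'} hc hc' hcc => ?_
    obtain ⟨-, -, q', hq', hhi⟩ := hcs2 c hc
    obtain ⟨-, ⟨p', hp', hlo⟩, -⟩ := hcs2 c' hc'
    rw [hhi, hlo]
    exact hcc q' hq' p' hp'
  · intro r hr
    rw [hpairs] at hr
    exact ⟨hmin r hr, hmax r hr⟩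
  · rw [hpairs]
    exact hT
  · exact ((freshIds_ofNat (by omega)).append hTids).append hcs3

theorem SortedBy.of_mem {i : ℕ} {ls : List (List (Pair d nk nr))} (h : SortedBy i ls.flatten)
    {l : List (Pair d nk nr)} (hl : l ∈ ls) : SortedBy i l :=
  (List.pairwise_flatten.1 h).1 l hl

/-- As `4` divides `B`, so does it divide the largest weight of a node. -/
theorem exists_four_mul_eq (hb : 2 ≤ b) (h : ℕ) : ∃ q, (2 ^ b) ^ (h + 1) = 4 * q := by
  refine ⟨(2 ^ b) ^ h * 2 ^ (b - 2), ?_⟩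
  obtain ⟨b, rfl⟩ : ∃ c, b = c + 2 := ⟨b - 2, by omega⟩
  rw [Nat.add_sub_cancel, pow_succ, pow_add 2 b 2]
  ring

theorem nodeExists_of_pieces (haux : ∀ l : List (Pair d nk nr), TreeExists b n l)
    {h q c : ℕ} (hq : (2 ^ b) ^ (h + 1) = 4 * q)
    (hchild : ∀ l : List (Pair d nk nr), SortedBy n l → (2 ^ b) ^ (h + 1) ≤ 4 * l.length →
      l.length ≤ (2 ^ b) ^ (h + 1) → NodeExists b n h l)
    {l : List (Pair d nk nr)} (hs : SortedBy n l) (hc2 : 2 ≤ c) (hcB : c ≤ 2 ^ b)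
    (h1 : c * q ≤ l.length) (h2 : l.length ≤ c * (4 * q)) : NodeExists b n (h + 1) l := by
  obtain ⟨ls, rfl, rfl, hls⟩ := exists_pieces (by omega : q ≤ 4 * q) c l h1 h2
  have hbal : ∀ l ∈ ls, (2 ^ b) ^ (h + 1) ≤ 4 * l.length ∧ l.length ≤ (2 ^ b) ^ (h + 1) := by
    intro l hl
    have := hls l hl
    omega
  exact nodeExists_inner haux
    (fun l hl => hchild l (hs.of_mem hl) (hbal l hl).1 (hbal l hl).2) hbal hc2 hcB hs

/-- A balanced node is built with `B` children. -/
theorem nodeExists_of_balanced (hb : 2 ≤ b) (haux : ∀ l : List (Pair d nk nr), TreeExists b n l)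
    (h : ℕ) (l : List (Pair d nk nr)) (hs : SortedBy n l)
    (h1 : (2 ^ b) ^ (h + 1) ≤ 4 * l.length) (h2 : l.length ≤ (2 ^ b) ^ (h + 1)) :
    NodeExists b n h l := by
  induction h generalizing l with
  | zero =>
    refine nodeExists_leaf hs ?_ (by simpa using h2)
    rintro rfl
    have : 0 < (2 ^ b) ^ (0 + 1) := by positivity
    simp at h1
  | succ h ih =>
    obtain ⟨q, hq⟩ := exists_four_mul_eq hb h
    rw [pow_succ _ (h + 1), hq] at h1 h2
    exact nodeExists_of_pieces haux hq ih hs (Nat.le_self_pow (by omega) 2) le_rfl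
      (by linarith) (by linarith)

theorem NodeExists.treeExists {h : ℕ} {l l' : List (Pair d nk nr)} (hl : NodeExists b n h l')
    (hp : l'.Perm l) : TreeExists b (n + 1) l := by
  obtain ⟨K, hK⟩ := hl
  refine ⟨K, fun w a ha => ?_⟩
  obtain ⟨v, hv1, hv2, hv3, -, hv4⟩ := hK w a ha
  exact ⟨(⟨h, v⟩ : BPlusTree d nk nr w _), ⟨hv1 ▸ hp, hv2, hv3⟩, hv4⟩

/-- The height of a root that is not a leaf is chosen such that
`B ^ h < N ≤ B ^ (h + 1)`, and the number of its children is `N / B ^ h`, rounded up. -/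
theorem treeExists (hb : 2 ≤ b) (n : ℕ) (l : List (Pair d nk nr)) : TreeExists b n l := by
  induction n generalizing l with
  | zero => exact ⟨0, fun w a _ => ⟨(), trivial, freshIds_nil⟩⟩
  | succ n ih =>
    obtain ⟨l', hp, hs⟩ := exists_sortedBy_perm n l
    rcases eq_or_ne l' [] with rfl | hne
    · refine ⟨1, fun w a ha => ?_⟩
      exact ⟨(⟨0, (⟨BitVec.ofNat w a, 0, 0, []⟩ : Leaf d nk nr w)⟩ : BPlusTree d nk nr w _),
        ⟨hp, trivial, by simp [Node.pairs], List.Pairwise.nil, fun r hr => by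
          simp [Node.pairs] at hr⟩, freshIds_ofNat ha⟩
    rcases le_or_gt l'.length (2 ^ b) with hlen | hlen
    · exact (nodeExists_leaf hs hne hlen).treeExists hp
    have hB : 1 < 2 ^ b := Nat.one_lt_two_pow (by omega)
    set k := Nat.clog (2 ^ b) l'.length with hk
    have hk1 : l'.length ≤ (2 ^ b) ^ k := Nat.le_pow_clog hB _
    have hk2 : (2 ^ b) ^ k.pred < l'.length := Nat.pow_pred_clog_lt_self hB (by omega)
    obtain ⟨h, hkh⟩ : ∃ h, k = h + 2 := by
      refine ⟨k - 2, ?_⟩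
      by_contra hcon
      have : (2 ^ b) ^ k ≤ (2 ^ b) ^ 1 := Nat.pow_le_pow_right (by omega) (by omega)
      rw [pow_one] at this
      omega
    rw [hkh] at hk1 hk2
    obtain ⟨q, hq⟩ := exists_four_mul_eq hb h
    rw [pow_succ _ (h + 1), hq] at hk1
    change (2 ^ b) ^ (h + 1) < _ at hk2
    rw [hq] at hk2
    have hq0 : 0 < 4 * q := by
      rw [← hq]
      positivity
    have hdiv := Nat.div_add_mod (l'.length - 1) (4 * q)
    have hmod := Nat.mod_lt (l'.length - 1) hq0
    set e := (l'.length - 1) / (4 * q) with he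
    have he1 : 1 ≤ e := (Nat.le_div_iff_mul_le hq0).2 (by omega)
    have he2 : e < 2 ^ b := (Nat.div_lt_iff_lt_mul hq0).2 (by rw [mul_comm]; omega)
    have heq : q ≤ e * q := Nat.le_mul_of_pos_left q he1
    refine (nodeExists_of_pieces ih hq (nodeExists_of_balanced hb ih h) hs
      (c := e + 1) (by omega) he2 ?_ ?_).treeExists hp
    · have : 4 * q * e = 4 * (e * q) := by ring
      rw [add_mul]
      omega
    · have : (e + 1) * (4 * q) = 4 * q * e + 4 * q := by ring
      omega

theorem exists_isQuantumRangeTree (hb : 2 ≤ b) (D : Finset (Pair d nk nr)) :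
    ∃ (w : ℕ) (T : RangeTree d nk nr w d), IsQuantumRangeTree b D T := by
  obtain ⟨K, hK⟩ := treeExists hb d D.toList
  -- Identifiers start from `1`, since `0` is the mark `dummy`.
  obtain ⟨T, hT, hids⟩ := hK (K + 1) 1 (by
    have := Nat.lt_two_pow_self (n := K + 1)
    omega)
  refine ⟨K + 1, T, hT, hids.1, fun h0 => ?_⟩
  have := (hids.2 0 h0).1
  simp at this

end Existence

/-! ### The expected time of the query -/

section Time

variable {d nk nr w b : ℕ}

theorem circuitTime_walkCircuit (d b w H : ℕ) :
    circuitTime d b (walkCircuit w H) = H * (b + 3) + (b + (2 * d + 2)) := by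
  rw [walkCircuit_eq]
  suffices ∀ m t, circuitTime d b (walkFrom w t m) = m * (b + 3) + (b + (2 * d + 2)) from
    this H 0
  intro m
  induction m with
  | zero =>
    intro t
    simp [walkFrom, circuitTime, Gate.time]
    omega
  | succ m ih =>
    intro t
    have := ih (t + 1)
    simp only [circuitTime, walkFrom, List.map_cons, List.sum_cons, Gate.time] at this ⊢
    rw [this]
    ring

theorem circuitTime_resetCircuit (d b H : ℕ) (L : List (BitVec w × ℕ)) :
    circuitTime d b (resetCircuit H L) = H + L.length * (H + 4) := by
  simp [circuitTime, resetCircuit, Function.comp_def, Gate.time]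

/-- The expected number of attempts is at most `A` if each of them succeeds with probability at
least `1 / A`. -/
theorem tsum_attempts_le {p A : ℝ} (hA : 1 ≤ A) (hp : 1 / A ≤ p) (t : ℝ≥0∞) :
    ∑' m : ℕ, ENNReal.ofReal (1 - p) ^ m * t ≤ ENNReal.ofReal A * t := by
  rw [ENNReal.tsum_mul_right, ENNReal.tsum_geometric]
  gcongr
  have hA0 : 0 < A := by linarith
  rw [one_div] at hp
  rw [← inv_inv (ENNReal.ofReal A), ENNReal.inv_le_inv, ← ENNReal.ofReal_inv_of_pos hA0]
  refine ENNReal.le_sub_of_add_le_right ENNReal.ofReal_ne_top ?_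
  calc ENNReal.ofReal A⁻¹ + ENNReal.ofReal (1 - p)
      ≤ ENNReal.ofReal A⁻¹ + ENNReal.ofReal (1 - A⁻¹) := by gcongr
    _ = 1 := by
        rw [← ENNReal.ofReal_add (by positivity) (sub_nonneg.2 (inv_le_one_of_one_le₀ hA)),
          add_sub_cancel, ENNReal.ofReal_one]

theorem sum_pow_height_cast (b : ℕ) (Cs : List (SNode d nk nr w)) :
    (Cs.map fun v => ((2 : ℝ) ^ b) ^ (v.height + 1)).sum =
      ((Cs.map fun v => (2 ^ b) ^ (v.height + 1)).sum : ℕ) := by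
  rw [Nat.cast_list_sum, List.map_map]
  congr 1
  refine List.map_congr_left fun v _ => ?_
  simp

theorem heightBound_succ_le (hb : b ≠ 0) {N : ℕ} (hN : 2 ≤ N) :
    ((heightBound b N + 1 : ℕ) : ℝ) ≤ (b + 2) * Real.logb ((2 : ℝ) ^ b) N := by
  have hb0 : (0 : ℝ) < b := by exact_mod_cast Nat.pos_of_ne_zero hb
  have hB : (1 : ℝ) < 2 ^ b := one_lt_pow₀ (by norm_num) hb
  have hN0 : (0 : ℝ) < N := by positivity
  have h2 : Real.logb ((2 : ℝ) ^ b) 2 = 1 / b := by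
    rw [Real.logb, Real.log_pow]
    have : Real.log 2 ≠ 0 := (Real.log_pos (by norm_num)).ne'
    field_simp
  have hlog : 1 / (b : ℝ) ≤ Real.logb ((2 : ℝ) ^ b) N := by
    rw [← h2]
    exact Real.logb_le_logb_of_le hB (by norm_num) (by exact_mod_cast hN)
  have hfloor : (heightBound b N : ℝ) ≤ Real.logb ((2 : ℝ) ^ b) (2 * N) := by
    rw [Real.le_logb_iff_rpow_le hB (by positivity), Real.rpow_natCast]
    exact_mod_cast Nat.pow_log_le_self (2 ^ b) (by omega)
  rw [Real.logb_mul (by norm_num) hN0.ne', h2] at hfloor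
  have h1 : 1 ≤ b * Real.logb ((2 : ℝ) ^ b) N := by
    have := mul_le_mul_of_nonneg_left hlog hb0.le
    rwa [mul_one_div_cancel hb0.ne'] at this
  push_cast
  linarith

/-- The constant in the bound for the expected time, in terms of `(heightBound b N + 1) ^ d`. -/
def queryConst (d b : ℕ) : ℕ :=
  searchConst d b (d - 1) +
    8 * 2 ^ b * (searchConst d b (d - 1) + ((b + 3) + (b + (2 * d + 2))) + 1) +
    (1 + searchConst d b (d - 1) * 5)

section Query

variable {D : Finset (Pair d nk nr)} {T : RangeTree d nk nr w d} {x y : Key d nk}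

theorem IsQuantumRangeTree.correct_search (hd : 1 ≤ d) (hT : IsQuantumRangeTree b D T) :
    (T.search x y d).Correct b x y (T.nodes d) D.toList := by
  obtain ⟨n, rfl⟩ : ∃ n, d = n + 1 := ⟨d - 1, by omega⟩
  exact RangeTree.correct_search hT.isFor fun p _ j hj => absurd j.isLt (by omega)

theorem length_filter_toList (D : Finset (Pair d nk nr)) (x y : Key d nk) :
    (D.toList.filter fun p => InRange x y p.1).length = (answers D x y).card := by
  rw [(toList_filter_eq D x y).length_eq, Finset.length_toList]

/-- There is a candidate exactly if there is an answer. -/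
theorem IsQuantumRangeTree.cands_eq_nil_iff (hd : 1 ≤ d) (hT : IsQuantumRangeTree b D T) :
    (T.search x y d).cands = [] ↔ answers D x y = ∅ := by
  obtain ⟨Cs, hc, -, hperm, hsum⟩ := hT.correct_search (x := x) (y := y) hd
  rw [hc, candList, List.map_eq_nil_iff, ← Finset.card_eq_zero]
  constructor
  · rintro rfl
    rw [← length_filter_toList, ← hperm.length_eq]
    rfl
  · intro h0
    rw [length_filter_toList, h0, mul_zero] at hsum
    rcases Cs with _ | ⟨v, Cs⟩
    · rfl
    · have : 0 < (2 ^ b) ^ (v.height + 1) := by positivity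
      simp only [List.map_cons, List.sum_cons] at hsum
      omega

theorem IsQuantumRangeTree.answer_eq_none (hd : 1 ≤ d) (hT : IsQuantumRangeTree b D T)
    (h : answers D x y = ∅) : T.answer b x y = none := by
  simp only [RangeTree.answer, (hT.cands_eq_nil_iff hd).2 h, if_true]

theorem IsQuantumRangeTree.answer_eq_some (hd : 1 ≤ d) (hT : IsQuantumRangeTree b D T)
    (h : (answers D x y).Nonempty) :
    T.answer b x y = some ((queryState D x y).mapDomain (output w b)) := by
  have hne := mt (hT.cands_eq_nil_iff (x := x) (y := y) hd).1 h.ne_empty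
  obtain ⟨Cs, hc, hmem, hperm, -⟩ := hT.correct_search (x := x) (y := y) hd
  simp only [RangeTree.answer, if_neg hne]
  rw [hc, run_reset_postSelect hT x y hmem hperm h]

theorem IsQuantumRangeTree.cost_search_le (hd : 1 ≤ d) (hb : b ≠ 0)
    (hT : IsQuantumRangeTree b D T) :
    (T.search x y d).cost (heightBound b D.card + 1) ≤
      searchConst d b (d - 1) * (heightBound b D.card + 1) ^ d := by
  obtain ⟨n, rfl⟩ : ∃ n, d = n + 1 := ⟨d - 1, by omega⟩
  exact RangeTree.cost_search_le hb hT.isFor (Finset.length_toList D).le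

theorem IsQuantumRangeTree.length_cands_add_oneDim_le (hd : 1 ≤ d) (hb : b ≠ 0)
    (hT : IsQuantumRangeTree b D T) :
    (T.search x y d).cands.length + (T.search x y d).oneDim ≤
      searchConst d b (d - 1) * (heightBound b D.card + 1) ^ (d - 1) := by
  have h := hT.cost_search_le (x := x) (y := y) hd hb
  have hpow : (heightBound b D.card + 1) ^ d =
      (heightBound b D.card + 1) * (heightBound b D.card + 1) ^ (d - 1) := by
    rw [← pow_succ']
    congr 1
    omega
  rw [hpow, mul_left_comm, Found.cost] at h
  exact Nat.le_of_mul_le_mul_left ((Nat.le_add_left _ _).trans h) (Nat.succ_pos _)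

theorem IsQuantumRangeTree.one_div_le_successProb (hd : 1 ≤ d) (hT : IsQuantumRangeTree b D T)
    (h : (answers D x y).Nonempty) :
    1 / (8 * 2 ^ b : ℝ) ≤
      successProb (walkState (T.memory b) x y (T.search x y d).cands) := by
  have hne := mt (hT.cands_eq_nil_iff (x := x) (y := y) hd).1 h.ne_empty
  obtain ⟨Cs, hc, hmem, hperm, hsum⟩ := hT.correct_search (x := x) (y := y) hd
  rw [hc, successProb_walkState hT x y hmem hperm, sum_pow_height_cast]
  rw [length_filter_toList] at hsum
  have hS : 0 < (Cs.map fun v => (2 ^ b) ^ (v.height + 1)).sum := by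
    rcases Cs with _ | ⟨v, Cs⟩
    · exact absurd hc hne
    · have : 0 < (2 ^ b) ^ (v.height + 1) := by positivity
      simp only [List.map_cons, List.sum_cons]
      omega
  rw [div_le_div_iff₀ (by positivity) (by exact_mod_cast hS), one_mul, mul_comm]
  exact_mod_cast hsum

theorem IsQuantumRangeTree.topHeight_le (hd : 1 ≤ d) (hb : b ≠ 0)
    (hT : IsQuantumRangeTree b D T) :
    topHeight (T.search x y d).cands ≤ heightBound b D.card := by
  obtain ⟨Cs, hc, hmem, -⟩ := hT.correct_search (x := x) (y := y) hd
  rw [hc]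
  clear hc
  induction Cs with
  | nil => exact Nat.zero_le _
  | cons v Cs ih =>
    exact max_le (hT.isFor.height_le hb (Finset.length_toList D).le (hmem v List.mem_cons_self))
      (ih fun v hv => hmem v (List.mem_cons_of_mem _ hv))

theorem IsQuantumRangeTree.expectedTime_le (hd : 1 ≤ d) (hb : b ≠ 0)
    (hT : IsQuantumRangeTree b D T) :
    T.expectedTime b x y ≤ ((queryConst d b * (heightBound b D.card + 1) ^ d : ℕ) : ℝ≥0∞) := by
  have hcost := hT.cost_search_le (x := x) (y := y) hd hb
  have hlen := hT.length_cands_add_oneDim_le (x := x) (y := y) hd hb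
  have hH := hT.topHeight_le (x := x) (y := y) hd hb
  set m := heightBound b D.card + 1 with hm
  set c := searchConst d b (d - 1) with hc
  have hm1 : 1 ≤ m := by omega
  have hpow : m ^ d = m * m ^ (d - 1) := by
    rw [← pow_succ']
    congr 1
    omega
  have hpow1 : 1 ≤ m ^ (d - 1) := Nat.one_le_pow _ _ hm1
  have hmd : m ≤ m ^ d := by
    rw [hpow]
    exact Nat.le_mul_of_pos_right _ hpow1
  have hsteps : (T.search x y d).steps ≤ c * m ^ d := (Nat.le_add_right _ _).trans hcost
  have hlen' : (T.search x y d).cands.length ≤ c * m ^ (d - 1) :=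
    (Nat.le_add_right _ _).trans hlen
  simp only [RangeTree.expectedTime]
  split_ifs with h0
  · refine Nat.cast_le.2 (hsteps.trans (Nat.mul_le_mul_right _ ?_))
    rw [queryConst]
    omega
  have hne : (answers D x y).Nonempty :=
    Finset.nonempty_iff_ne_empty.2 fun h => h0 ((hT.cands_eq_nil_iff hd).2 h)
  have hattempt : attemptTime d b (T.search x y d).cands ≤
      (c + ((b + 3) + (b + (2 * d + 2))) + 1) * m ^ d := by
    rw [attemptTime, circuitTime_walkCircuit]
    have h1 : c * m ^ (d - 1) ≤ c * m ^ d :=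
      Nat.mul_le_mul_left _ (by rw [hpow]; exact Nat.le_mul_of_pos_left _ hm1)
    have h2 : topHeight (T.search x y d).cands * (b + 3) ≤ (b + 3) * m ^ d := by
      rw [mul_comm]
      exact Nat.mul_le_mul_left _ (by omega)
    have h3 : b + (2 * d + 2) ≤ (b + (2 * d + 2)) * m ^ d :=
      Nat.le_mul_of_pos_right _ (by omega)
    rw [add_mul, add_mul, add_mul]
    omega
  have hreset : circuitTime d b (resetCircuit (topHeight (T.search x y d).cands)
      (T.search x y d).cands) ≤ (1 + c * 5) * m ^ d := by
    rw [circuitTime_resetCircuit]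
    have h1 : (T.search x y d).cands.length * (topHeight (T.search x y d).cands + 4) ≤
        c * m ^ (d - 1) * (5 * m) := Nat.mul_le_mul hlen' (by omega)
    have h2 : c * m ^ (d - 1) * (5 * m) = c * 5 * m ^ d := by
      rw [hpow]
      ring
    rw [add_mul]
    omega
  have htsum := tsum_attempts_le (A := 8 * 2 ^ b)
    (by linarith [one_le_pow₀ (n := b) (show (1 : ℝ) ≤ 2 by norm_num)])
    (hT.one_div_le_successProb hd hne) (attemptTime d b (T.search x y d).cands : ℝ≥0∞)
  have hofReal : ENNReal.ofReal (8 * 2 ^ b) = ((8 * 2 ^ b : ℕ) : ℝ≥0∞) := by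
    rw [← ENNReal.ofReal_natCast]
    push_cast
    rfl
  rw [hofReal, ← Nat.cast_mul] at htsum
  refine (add_le_add (add_le_add (Nat.cast_le.2 hsteps)
    (htsum.trans (Nat.cast_le.2 (Nat.mul_le_mul_left _ hattempt))))
    (Nat.cast_le.2 hreset)).trans (le_of_eq ?_)
  rw [queryConst, ← Nat.cast_add, ← Nat.cast_add]
  congr 1
  ring

end Query

end Time

end QuantumRange

theorem mainTheorem6 (d b : ℕ) (hd : 1 ≤ d) (hb : 2 ≤ b) :
    (∀ (nk nr : ℕ) (D : Finset (QuantumRange.Pair d nk nr)),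
      ∃ (w : ℕ) (T : QuantumRange.RangeTree d nk nr w d),
        QuantumRange.IsQuantumRangeTree b D T) ∧
    ∃ C : ℝ, ∀ (nk nr w : ℕ) (D : Finset (QuantumRange.Pair d nk nr))
      (T : QuantumRange.RangeTree d nk nr w d), QuantumRange.IsQuantumRangeTree b D T →
      ∀ x y : QuantumRange.Key d nk,
        ((QuantumRange.answers D x y).Nonempty →
          T.answer b x y =
            some ((QuantumRange.queryState D x y).mapDomain (QuantumRange.output w b))) ∧
        (QuantumRange.answers D x y = ∅ → T.answer b x y = none) ∧
        (2 ≤ D.card →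
          T.expectedTime b x y ≤
            ENNReal.ofReal (C * Real.logb ((2 : ℝ) ^ b) (D.card : ℝ) ^ d) ∧
          ((T.search x y d).oneDim : ℝ) ≤
            C * Real.logb ((2 : ℝ) ^ b) (D.card : ℝ) ^ (d - 1)) := by

  refine ⟨fun nk nr D => QuantumRange.exists_isQuantumRangeTree hb D,
    (QuantumRange.queryConst d b : ℝ) * (b + 2) ^ d, fun nk nr w D T hT x y =>
      ⟨hT.answer_eq_some hd, hT.answer_eq_none hd, fun hN => ⟨?_, ?_⟩⟩⟩
  · refine (hT.expectedTime_le hd (by omega)).trans ?_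
    rw [← ENNReal.ofReal_natCast]
    refine ENNReal.ofReal_le_ofReal ?_
    rw [Nat.cast_mul, Nat.cast_pow, mul_assoc, ← mul_pow]
    gcongr
    exact QuantumRange.heightBound_succ_le (by omega) hN
  · have hlog : 0 ≤ Real.logb ((2 : ℝ) ^ b) (D.card : ℝ) :=
      Real.logb_nonneg (one_lt_pow₀ (by norm_num) (by omega)) (by exact_mod_cast (by omega))
    have h1 : (T.search x y d).oneDim ≤ QuantumRange.queryConst d b *
        (QuantumRange.heightBound b D.card + 1) ^ (d - 1) := by
      refine ((Nat.le_add_left _ _).trans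
        (hT.length_cands_add_oneDim_le hd (by omega))).trans (Nat.mul_le_mul_right _ ?_)
      rw [QuantumRange.queryConst]
      omega
    calc ((T.search x y d).oneDim : ℝ)
        ≤ QuantumRange.queryConst d b *
          ((QuantumRange.heightBound b D.card + 1 : ℕ) : ℝ) ^ (d - 1) := by exact_mod_cast h1
      _ ≤ QuantumRange.queryConst d b *
          ((b + 2) * Real.logb ((2 : ℝ) ^ b) (D.card : ℝ)) ^ (d - 1) := by
          gcongr
          exact QuantumRange.heightBound_succ_le (by omega) hN
      _ = QuantumRange.queryConst d b * (b + 2) ^ (d - 1) *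
          Real.logb ((2 : ℝ) ^ b) (D.card : ℝ) ^ (d - 1) := by rw [mul_pow, mul_assoc]
      _ ≤ _ := by
          gcongr
          · linarith [Nat.cast_nonneg (α := ℝ) b]
          · omega
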